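/- Let $\mathcal H,\mathcal K$ be complex Hilbert spaces, $\mathbb V$ a right $\mathcal L(\mathcal H)$-module (unital, with compatible complex vector space structure), $G$ a group, $U$ a group homomorphism from $G$ to the group of $\mathcal L(\mathcal H)$-linear bijections of $\mathbb V$, and $\beta$ an action of $G$ on $\mathcal L(\mathcal K)$ by $*$-automorphisms. Write $\beta_g(b)=u_gbu_g^*$ with unitaries $u_g\in\mathcal L(\mathcal K)$ satisfying $u_{gh}=m(g,h)u_gu_h$, where $m:G\times G\to\mathbb T$ is a 2-cocycle: $m(e,g)=m(g,e)=1$ and $m(g,hk)m(h,k)=m(gh,k)m(g,h)$. Let $S_{\mathcal L(\mathcal H)}(\mathbb V)$ be the vector space of maps $s:\mathbb V\times\mathbb V\to\mathcal L(\mathcal H)$ that are linear in the second and conjugate linear in the first argument and satisfy $s(v,wa)=s(v,w)a$, $s(va,w)=a^*s(v,w)$ for $a\in\mathcal L(\mathcal H)$. Fix $s_1\in S_{\mathcal L(\mathcal H)}(\mathbb V)$ and let $\mathbf{NCP}_\beta^U(s_1)$ be the convex set of linear maps $S:\mathcal L(\mathcal K)\to S_{\mathcal L(\mathcal H)}(\mathbb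 V)$, $b\mapsto S_b$, with $S_{I_{\mathcal K}}=s_1$ that are completely positive ($\sum_{j,k=1}^nS_{b_j^*b_k}(v_j,v_k)\ge0$ for all $n$, $b_j\in\mathcal L(\mathcal K)$, $v_j\in\mathbb V$), covariant ($S_{\beta_g(b)}(v,w)=S_b(U(g^{-1})v,U(g^{-1})w)$), and normal ($b\mapsto S_b(v,v)$ is $\sigma$-weakly continuous for every $v\in\mathbb V$). The $\sigma$-strong topology of $\mathcal L(\mathcal H;\mathcal H')$, for a Hilbert space $\mathcal H'$, is given by the seminorms $x\mapsto(\sum_j\|x\xi_j\|^2)^{1/2}$, where $(\xi_j)$ runs over the sequences in $\mathcal H$ with $\sum_j\|\xi_j\|^2<\infty$. Let $S\in\mathbf{NCP}_\beta^U(s_1)$. Then there are a Hilbert space $\mathcal K'$ and an $\mathcal L(\mathcal H)$-linear map $J:\mathbb V\to\mathcal L(\mathcal H;\mathcal K\otimes\mathcal K')$ such that $$S_b(v,w)=(Jv)^*(b\otimes I_{\mathcal K'})(Jw),\qquad b\in\mathcal L(\mathcal K),\ v,w\in\mathbb V,$$ and the linear span of $\{(b\otimes I_{\mathcal K'})(Jv)\,|\,b\in\mathcal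 L(\mathcal K),\ v\in\mathbb V\}$ is $\sigma$-strongly dense in $\mathcal L(\mathcal H;\mathcal K\otimes\mathcal K')$. Moreover, there are unitaries $u'_g\in\mathcal L(\mathcal K')$, $g\in G$, forming an $m$-multiplier representation, i.e. $u'_e=I_{\mathcal K'}$ and $u'_gu'_h=m(g,h)u'_{gh}$, such that $JU(g)=(u_g\otimes u'_g)J$ for all $g\in G$. The map $S$ is an extreme point of $\mathbf{NCP}_\beta^U(s_1)$ if and only if, for every $D'\in\mathcal L(\mathcal K')$, the conditions $D'u'_g=u'_gD'$ for all $g\in G$ and $(Jv)^*(I_{\mathcal K}\otimes D')(Jv)=0$ for all $v\in\mathbb V$ imply $D'=0$. Furthermore, there are a set $\Lambda$ and $\mathcal L(\mathcal H)$-linear maps $\mathsf A_\lambda:\mathbb V\to\mathcal L(\mathcal H;\mathcal K)$, $\lambda\in\Lambda$, such that $$S_b(v,w)=\sum_{\lambda\in\Lambda}(\mathsf A_\lambda v)^*b(\mathsf A_\lambda w),\qquad b\in\mathcal L(\mathcal K),\ v,w\in\mathbb V,$$ where the net of finite partial sums converges $\sigma$-strongly in $\mathcal L(\mathcal H)$.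 -/

import Mathlib

open scoped TensorProduct ENNReal

universe uH uK uV uG

noncomputable section

namespace CovCP

/-! Operators between Hilbert spaces: the Hilbert space tensor product, and the `σ`-strong and
`σ`-weak topologies. -/

/-- The Hilbert space tensor product: the completion of the algebraic tensor product with the
inner product determined by `⟪x ⊗ y, x' ⊗ y'⟫ = ⟪x, x'⟫ * ⟪y, y'⟫`. -/
abbrev HilbertTensor (E F : Type*) [NormedAddCommGroup E] [InnerProductSpace ℂ E]
    [NormedAddCommGroup F] [InnerProductSpace ℂ F] : Type _ :=
  UniformSpace.Completion (E ⊗[ℂ] F)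

/-- The bounded operator `a ⊗ d` on the Hilbert space tensor product `E ⊗ F`. -/
def opTensor {E F : Type*} [NormedAddCommGroup E] [InnerProductSpace ℂ E]
    [NormedAddCommGroup F] [InnerProductSpace ℂ F]
    (a : E →L[ℂ] E) (d : F →L[ℂ] F) : HilbertTensor E F →L[ℂ] HilbertTensor E F :=
  (TensorProduct.mapL a d).completion

section Topologies

variable {H E : Type*} [NormedAddCommGroup H] [InnerProductSpace ℂ H]
  [NormedAddCommGroup E] [InnerProductSpace ℂ E]

theorem memlp_map (m : H →L[ℂ] E) (ξ : lp (fun _ : ℕ => H) 2) :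
    Memℓp (fun j => m (ξ j)) (2 : ℝ≥0∞) := by
  have h0 : (0 : ℝ) < (2 : ℝ≥0∞).toReal := by norm_num
  have hs := (lp.memℓp ξ).summable h0
  refine memℓp_gen ((hs.mul_left (‖m‖ ^ (2 : ℝ≥0∞).toReal)).of_nonneg_of_le
    (fun j => by positivity) fun j => ?_)
  rw [← Real.mul_rpow (norm_nonneg _) (norm_nonneg _)]
  exact Real.rpow_le_rpow (norm_nonneg _) (m.le_opNorm _) h0.le

/-- The square-summable sequence `(m ξ_j)_j`, for a square-summable sequence `(ξ_j)_j`. -/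
def ampl (m : H →L[ℂ] E) (ξ : lp (fun _ : ℕ => H) 2) : lp (fun _ : ℕ => E) 2 :=
  ⟨fun j => m (ξ j), memlp_map m ξ⟩

variable (H E)

/-- The `σ`-strong topology of `L(H; E)`: the topology of the seminorms
`m ↦ (∑ j, ‖m ξ_j‖²)^(1/2)`, where `(ξ_j)_j` runs over the square-summable sequences in `H`. -/
abbrev sigmaStrong : TopologicalSpace (H →L[ℂ] E) :=
  ⨅ ξ : lp (fun _ : ℕ => H) 2, TopologicalSpace.induced (fun m => ampl m ξ) inferInstance

/-- The `σ`-weak topology of `L(H; E)`: the topology of the seminorms `m ↦ |∑ j, ⟪η_j, m ξ_j⟫|`,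
where `(ξ_j)_j` and `(η_j)_j` run over the square-summable sequences in `H` and `E`. -/
abbrev sigmaWeak : TopologicalSpace (H →L[ℂ] E) :=
  ⨅ p : lp (fun _ : ℕ => E) 2 × lp (fun _ : ℕ => H) 2,
    TopologicalSpace.induced (fun m => inner ℂ p.1 (ampl m p.2)) inferInstance

end Topologies

/-! Modules over `L(H)`. A right `L(H)`-module is a module over the opposite ring `L(H)ᵐᵒᵖ`: the
vector usually written `v a` is `MulOpposite.op a • v`. -/

/-- `s : V × V → L(H)` is an `L(H)`-sesquilinear form on the right `L(H)`-module `V`. -/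
structure IsSesqForm {H V : Type*} [NormedAddCommGroup H] [InnerProductSpace ℂ H]
    [CompleteSpace H] [AddCommGroup V] [Module ℂ V] [Module (H →L[ℂ] H)ᵐᵒᵖ V]
    (s : V → V → (H →L[ℂ] H)) : Prop where
  add_smul_right : ∀ (u v w : V) (c : ℂ), s u (v + c • w) = s u v + c • s u w
  add_smul_left : ∀ (u v w : V) (c : ℂ), s (v + c • w) u = s v u + star c • s w u
  op_right : ∀ (u v : V) (a : H →L[ℂ] H), s u (MulOpposite.op a • v) = s u v * a
  op_left : ∀ (u v : V) (a : H →L[ℂ] H), s (MulOpposite.op a • u) v = star a * s u v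

/-- `J : V → L(H; E)` is `L(H)`-linear: `J (v a) = (J v) a` (in addition to being linear). -/
def IsModuleMap {H V E : Type*} [NormedAddCommGroup H] [InnerProductSpace ℂ H]
    [NormedAddCommGroup E] [InnerProductSpace ℂ E]
    [AddCommGroup V] [Module ℂ V] [Module (H →L[ℂ] H)ᵐᵒᵖ V]
    (J : V →ₗ[ℂ] (H →L[ℂ] E)) : Prop :=
  ∀ (v : V) (a : H →L[ℂ] H), J (MulOpposite.op a • v) = (J v).comp a

/-! Completely positive maps `S : L(K) → S_{L(H)}(V)`, where `S_{L(H)}(V)` is the vector space of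
`L(H)`-sesquilinear forms on `V`; its operations are pointwise. -/

section CP

variable {H : Type*} [NormedAddCommGroup H] [InnerProductSpace ℂ H] [CompleteSpace H]
  {K : Type*} [NormedAddCommGroup K] [InnerProductSpace ℂ K] [CompleteSpace K]
  {V : Type*} [AddCommGroup V] [Module ℂ V] [Module (H →L[ℂ] H)ᵐᵒᵖ V]
  {G : Type*} [Group G]

/-- Complete positivity: `∑_{j,k} S_{b_j* b_k}(v_j, v_k) ≥ 0`. -/
def IsCP (S : (K →L[ℂ] K) →ₗ[ℂ] (V → V → (H →L[ℂ] H))) : Prop :=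
  ∀ (n : ℕ) (b : Fin n → (K →L[ℂ] K)) (v : Fin n → V),
    (∑ j, ∑ k, S (star (b j) * b k) (v j) (v k)).IsPositive

/-- `(β, U)`-covariance. -/
def IsCovariant (β : G →* ((K →L[ℂ] K) ≃⋆ₐ[ℂ] (K →L[ℂ] K)))
    (U : G →* (V ≃ₗ[(H →L[ℂ] H)ᵐᵒᵖ] V))
    (S : (K →L[ℂ] K) →ₗ[ℂ] (V → V → (H →L[ℂ] H))) : Prop :=
  ∀ (g : G) (b : K →L[ℂ] K) (v w : V),
    S (β g b) v w = S b (U g⁻¹ v) (U g⁻¹ w)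

/-- Normality: every map `b ↦ S_b(v, v)` is continuous for the `σ`-weak topologies. -/
def IsNormal (S : (K →L[ℂ] K) →ₗ[ℂ] (V → V → (H →L[ℂ] H))) : Prop :=
  ∀ v : V, @Continuous _ _ (sigmaWeak K K) (sigmaWeak H H)
    (fun b : K →L[ℂ] K => S b v v)

/-- The set of normal `(β, U)`-covariant completely positive maps
`S : L(K) → S_{L(H)}(V)` with `S_I = s₁`. -/
def NCP (β : G →* ((K →L[ℂ] K) ≃⋆ₐ[ℂ] (K →L[ℂ] K)))
    (U : G →* (V ≃ₗ[(H →L[ℂ] H)ᵐᵒᵖ] V)) (s₁ : V → V → (H →L[ℂ] H)) :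
    Set ((K →L[ℂ] K) →ₗ[ℂ] (V → V → (H →L[ℂ] H))) :=
  {S | (∀ b, IsSesqForm (S b)) ∧ IsCP S ∧ IsCovariant β U S ∧ IsNormal S ∧ S 1 = s₁}

end CP

/-! Cocycles and multiplier representations. -/

section Multipliers

variable {G : Type*} [Group G]

/-- `m` is a `𝕋`-valued 2-cocycle of the group `G`. -/
structure IsCocycle (m : G → G → Circle) : Prop where
  one_left : ∀ g, m 1 g = 1
  one_right : ∀ g, m g 1 = 1
  assoc : ∀ g h k, m g (h * k) * m h k = m (g * h) k * m g h

/-- The `G`-action `β` on `L(K)` is implemented by the unitaries `u_g`, with associated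
2-cocycle `m`: `β_g(b) = u_g b u_g*` and `u_{gh} = m(g,h) u_g u_h`. -/
structure Implements {K : Type*} [NormedAddCommGroup K] [InnerProductSpace ℂ K] [CompleteSpace K]
    (β : G →* ((K →L[ℂ] K) ≃⋆ₐ[ℂ] (K →L[ℂ] K))) (u : G → unitary (K →L[ℂ] K))
    (m : G → G → Circle) : Prop where
  cocycle : IsCocycle m
  conj : ∀ g b, β g b = (u g : K →L[ℂ] K) * b * star (u g : K →L[ℂ] K)
  mul : ∀ g h, (u (g * h) : K →L[ℂ] K) = (m g h : ℂ) • ((u g : K →L[ℂ] K) * (u h : K →L[ℂ] K))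

/-- `w` is a unitary `m`-multiplier representation on `E`: `w_e = I` and
`w_g w_h = m(g,h) w_{gh}`. -/
def IsMultiplierRep {E : Type*} [NormedAddCommGroup E] [InnerProductSpace ℂ E] [CompleteSpace E]
    (m : G → G → Circle) (w : G → unitary (E →L[ℂ] E)) : Prop :=
  w 1 = 1 ∧
  ∀ g h, (w g : E →L[ℂ] E) * (w h : E →L[ℂ] E) = (m g h : ℂ) • (w (g * h) : E →L[ℂ] E)

/-- Every action of `G` on `L(K)` is implemented by unitaries. -/
theorem exists_implements {K : Type*} [NormedAddCommGroup K] [InnerProductSpace ℂ K]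
    [CompleteSpace K] (β : G →* ((K →L[ℂ] K) ≃⋆ₐ[ℂ] (K →L[ℂ] K))) :
    ∃ (u : G → unitary (K →L[ℂ] K)) (m : G → G → Circle), Implements β u m := by
  classical
  have hcont : ∀ f : (K →L[ℂ] K) ≃⋆ₐ[ℂ] (K →L[ℂ] K), Continuous f := fun f =>
    (StarAlgEquiv.isometry f).continuous
  rcases subsingleton_or_nontrivial K with hK | hK
  · refine ⟨fun _ => 1, fun _ _ => 1, ⟨⟨by simp, by simp, by simp⟩, ?_, ?_⟩⟩
    · intro g b; exact Subsingleton.elim _ _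
    · intro g h; exact Subsingleton.elim _ _
  have key : ∀ g, ∃ w : unitary (K →L[ℂ] K), (g = 1 → w = 1) ∧
      ∀ b, β g b = (w : K →L[ℂ] K) * b * star (w : K →L[ℂ] K) := by
    intro g
    by_cases hg : g = 1
    · exact ⟨1, fun _ => rfl, fun b => by simp [hg]⟩
    · obtain ⟨e, he⟩ := StarAlgEquiv.eq_linearIsometryEquivConjStarAlgEquiv (β g)
        (hcont (β g))
      refine ⟨Unitary.linearIsometryEquiv.symm e, fun h => absurd h hg, fun b => ?_⟩
      rw [he, ← Unitary.conjStarAlgAut_symm_unitaryLinearIsometryEquiv]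
      rfl
  choose u hu1 hu using key
  have hu1' : (u 1 : K →L[ℂ] K) = 1 := by rw [hu1 1 rfl]; rfl
  have phase : ∀ a b : unitary (K →L[ℂ] K),
      (∀ x : K →L[ℂ] K, (a : K →L[ℂ] K) * x * star (a : K →L[ℂ] K)
        = (b : K →L[ℂ] K) * x * star (b : K →L[ℂ] K)) →
      ∃ z : Circle, (a : K →L[ℂ] K) = (z : ℂ) • (b : K →L[ℂ] K) := by
    intro a b hab
    obtain ⟨α, hα⟩ := (LinearIsometryEquiv.conjStarAlgEquiv_ext_iff
      (Unitary.linearIsometryEquiv a) (Unitary.linearIsometryEquiv b)).1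
      (StarAlgEquiv.ext hab)
    have hz : ‖(α : ℂ)‖ = 1 := CStarRing.norm_of_mem_unitary α.2
    refine ⟨⟨(α : ℂ), mem_sphere_zero_iff_norm.2 hz⟩, ?_⟩
    ext x
    exact congrArg (fun e : K ≃ₗᵢ[ℂ] K => e x) hα
  have cancel : ∀ (w : unitary (K →L[ℂ] K)) (z z' : Circle),
      (z : ℂ) • (w : K →L[ℂ] K) = (z' : ℂ) • (w : K →L[ℂ] K) → z = z' := by
    intro w z z' h
    have h1 := congrArg (fun T => T * star (w : K →L[ℂ] K)) h
    simp only [smul_mul_assoc, Unitary.mul_star_self_of_mem w.2] at h1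
    exact Circle.ext (smul_left_injective ℂ (one_ne_zero (α := K →L[ℂ] K)) h1)
  have hm : ∀ g h, ∃ z : Circle,
      (u (g * h) : K →L[ℂ] K) = (z : ℂ) • ((u g : K →L[ℂ] K) * (u h : K →L[ℂ] K)) := by
    intro g h
    refine phase (u (g * h)) (u g * u h) fun x => ?_
    have h1 : β (g * h) x = β g (β h x) := by rw [map_mul]; rfl
    rw [hu, hu g, hu h] at h1
    simpa [mul_assoc] using h1
  choose m hm using hm
  refine ⟨u, m, ⟨⟨fun g => ?_, fun g => ?_, fun g h k => ?_⟩, hu, hm⟩⟩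
  · refine cancel (u g) _ _ ?_
    have := hm 1 g
    rw [one_mul, hu1', one_mul] at this
    rw [← this]; simp
  · refine cancel (u g) _ _ ?_
    have := hm g 1
    rw [mul_one, hu1', mul_one] at this
    rw [← this]; simp
  · refine cancel (u g * u h * u k) _ _ ?_
    have e1 : (u (g * (h * k)) : K →L[ℂ] K) = ((m g (h * k) * m h k : Circle) : ℂ) •
        ((u g * u h * u k : unitary (K →L[ℂ] K)) : K →L[ℂ] K) := by
      rw [hm g (h * k), hm h k]
      simp [smul_smul, mul_assoc]
    have e2 : (u (g * h * k) : K →L[ℂ] K) = ((m (g * h) k * m g h : Circle) : ℂ) •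
        ((u g * u h * u k : unitary (K →L[ℂ] K)) : K →L[ℂ] K) := by
      rw [hm (g * h) k, hm g h]
      simp [smul_smul, mul_assoc]
    rw [← e1, ← e2, mul_assoc]

end Multipliers

end CovCP

end

-- Evaluate `S` on rank-one operators: k((v,x,ξ),(w,y,η)) = ⟪ξ, S_{|x⟩⟨y|}(v,w) η⟫ is a scalar
-- kernel on V × K × H. It is positive semidefinite, because |x⟩⟨y| = (|e₀⟩⟨x|)* (|e₀⟩⟨y|) for any
-- unit vector e₀, which is the shape complete positivity asks for. Let K' be its Kolmogorov space,
-- with total family κ; here κ(v,x,ξ) is antilinear in x. Normality gives ∑ ‖κ(v,e_i,ξ)‖² = ⟪ξ,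
-- S_I(v,v) ξ⟫ along an orthonormal basis (e_i) of K, so (J v) ξ = ∑ e_i ⊗ κ(v,e_i,ξ) converges
-- (`exists_dilation`). The tensor form K ⊗ K' thus appears at once, with no Stinespring
-- representation to decompose. Normality also carries the dilation formula from rank-one operators
-- to all b (`IsDilation.eq_compression`).
--
-- The remaining structure is read off from κ. Covariance makes (v,x,ξ) ↦ (U_g v, u_g x, ξ) preserve
-- the kernel, hence it is implemented by a unitary u'_g; antilinearity in x replaces the conjugate
-- multiplier of u by m. Since (|x⟩⟨x'| ⊗ D)(J v) ξ = x ⊗ D κ(v,x',ξ), the operators (b ⊗ I) J v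
-- reach a total set of vectors (density), and D is determined by b ↦ (J v)* (b ⊗ D)(J w)
-- (`eq_zero_of_compress_eq_zero`).
--
-- Extremality is then Arveson's argument. A nonzero self-adjoint D in the commutant of u' that is
-- killed at b = I splits S into the compressions by 1 ± rD. Conversely, a convex component of S has
-- a kernel dominated, up to a factor, by that of S, so it is the compression by some D₁
-- (`exists_radonNikodym`), and D₁ - 1 satisfies the two conditions. The Kraus maps are the
-- components of J along an orthonormal basis of K'.

universe uX

set_option linter.unusedSectionVars false

noncomputable section

namespace CovCP

/-! ### Gram families of positive semidefinite kernels -/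

section Kolmogorov

open scoped ComplexConjugate

/-- A positive semidefinite scalar kernel is the Gram kernel of a total family in a Hilbert
space. -/
theorem exists_gram_family {X : Type uX} (k : X → X → ℂ) (herm : ∀ i j, conj (k i j) = k j i)
    (pos : ∀ f : X →₀ ℂ, 0 ≤ (f.sum fun i c => f.sum fun j d => conj c * d * k i j).re) :
    ∃ (E : Type uX) (_ : NormedAddCommGroup E) (_ : InnerProductSpace ℂ E) (_ : CompleteSpace E)
      (κ : X → E), (∀ i j, inner ℂ (κ i) (κ j) = k i j) ∧
        Dense (Submodule.span ℂ (Set.range κ) : Set E) := by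
  classical
  let core : PreInnerProductSpace.Core ℂ (X →₀ ℂ) :=
    { inner := fun f g => f.sum fun i c => g.sum fun j d => conj c * d * k i j
      conj_inner_symm := fun f g => by
        rw [Finsupp.sum_comm]
        simp only [map_finsuppSum]
        congr! 6
        simp only [map_mul, herm, Complex.conj_conj]
        ring
      add_left := fun f g h => by
        rw [Finsupp.sum_add_index'] <;> simp [← Finsupp.sum_add, add_mul]
      smul_left := fun f g c => by
        rw [Finsupp.sum_smul_index] <;> simp [Finsupp.mul_sum, ← mul_assoc]
      re_inner_nonneg := pos }
  let _ : SeminormedAddCommGroup (X →₀ ℂ) :=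
    InnerProductSpace.Core.toSeminormedAddCommGroup (𝕜 := ℂ)
  let _ : InnerProductSpace ℂ (X →₀ ℂ) := .ofCore core
  have inner_def : ∀ f g : X →₀ ℂ,
      inner ℂ f g = f.sum fun i c => g.sum fun j d => conj c * d * k i j := fun f g => rfl
  -- The form may be degenerate; completing the seminormed space also divides out its null vectors.
  let κ : X → UniformSpace.Completion (X →₀ ℂ) := fun i =>
    ((Finsupp.single i 1 : X →₀ ℂ) : UniformSpace.Completion (X →₀ ℂ))
  refine ⟨UniformSpace.Completion (X →₀ ℂ), inferInstance, inferInstance, inferInstance, κ, ?_, ?_⟩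
  · intro i j
    simp only [κ]
    rw [UniformSpace.Completion.inner_coe, inner_def]
    simp
  · refine UniformSpace.Completion.denseRange_coe.mono ?_
    rintro _ ⟨f, rfl⟩
    induction f using Finsupp.induction_linear with
    | zero => rw [UniformSpace.Completion.coe_zero]; exact (Submodule.span ℂ (Set.range κ)).zero_mem
    | add f g hf hg => rw [UniformSpace.Completion.coe_add]; exact Submodule.add_mem _ hf hg
    | single i c =>
      have : (Finsupp.single i c : X →₀ ℂ) = c • Finsupp.single i 1 := by simp
      rw [this, UniformSpace.Completion.coe_smul]
      exact Submodule.smul_mem _ _ (Submodule.subset_span ⟨i, rfl⟩)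

variable {X E F : Type*} [NormedAddCommGroup E] [InnerProductSpace ℂ E]
  [NormedAddCommGroup F] [InnerProductSpace ℂ F]

theorem eq_of_inner_total {κ : X → E} (hκ : Dense (Submodule.span ℂ (Set.range κ) : Set E))
    {x y : E} (h : ∀ i, inner ℂ (κ i) x = inner ℂ (κ i) y) : x = y := by
  have h1 : (innerSL ℂ x : E →L[ℂ] ℂ) = innerSL ℂ y := by
    refine ContinuousLinearMap.ext_on hκ ?_
    rintro _ ⟨i, rfl⟩
    have := congrArg conj (h i)
    simpa using this
  refine ext_inner_right ℂ fun v => ?_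
  simpa using congrArg (fun T : E →L[ℂ] ℂ => T v) h1

theorem eq_of_inner_total' {κ : X → E} (hκ : Dense (Submodule.span ℂ (Set.range κ) : Set E))
    {x y : E} (h : ∀ i, inner ℂ x (κ i) = inner ℂ y (κ i)) : x = y :=
  eq_of_inner_total hκ fun i => by
    have := congrArg conj (h i)
    simpa using this

theorem inner_linearCombination (κ : X → E) (f : X →₀ ℂ) :
    inner ℂ (Finsupp.linearCombination ℂ κ f) (Finsupp.linearCombination ℂ κ f) =
      f.sum fun i c => f.sum fun j d => conj c * d * inner ℂ (κ i) (κ j) := by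
  rw [Finsupp.linearCombination_apply, Finsupp.sum, sum_inner]
  simp only [inner_sum, Finsupp.sum, inner_smul_left, inner_smul_right]
  exact Finset.sum_congr rfl fun i _ => Finset.sum_congr rfl fun j _ => by ring

/-- A family dominated by a total family is its image under a contraction. -/
theorem exists_contraction_of_dominated [CompleteSpace F] {κ : X → E} {κ' : X → F}
    (hκ : Dense (Submodule.span ℂ (Set.range κ) : Set E))
    (h : ∀ f : X →₀ ℂ, ‖Finsupp.linearCombination ℂ κ' f‖ ≤ ‖Finsupp.linearCombination ℂ κ f‖) :
    ∃ T : E →L[ℂ] F, ∀ i, T (κ i) = κ' i := by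
  have hd : DenseRange (Finsupp.linearCombination ℂ κ) := by
    have := hκ
    rw [← Finsupp.range_linearCombination] at this
    exact this
  refine ⟨(Finsupp.linearCombination ℂ κ').extendOfNorm (Finsupp.linearCombination ℂ κ),
    fun i => ?_⟩
  have := LinearMap.extendOfNorm_eq (f := Finsupp.linearCombination ℂ κ') hd
    ⟨1, fun f => by simpa using h f⟩ (Finsupp.single i 1)
  simpa using this

end Kolmogorov

/-! ### Elementary tensors, slices and operators on the Hilbert space tensor product -/

section Tensor

variable {E F : Type*} [NormedAddCommGroup E] [InnerProductSpace ℂ E]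
    [NormedAddCommGroup F] [InnerProductSpace ℂ F]

/-- The map `y ↦ x ⊗ y`. -/
def leftSlice (F : Type*) [NormedAddCommGroup F] [InnerProductSpace ℂ F] (x : E) :
    F →L[ℂ] HilbertTensor E F :=
  UniformSpace.Completion.toComplL ∘L TensorProduct.mkL ℂ E F x

/-- The map `x ↦ x ⊗ y`. -/
def rightSlice (E : Type*) [NormedAddCommGroup E] [InnerProductSpace ℂ E] (y : F) :
    E →L[ℂ] HilbertTensor E F :=
  UniformSpace.Completion.toComplL ∘L (TensorProduct.mkL ℂ E F).flip y

/-- The elementary tensor `x ⊗ y` in the Hilbert space tensor product. -/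
def htmul (x : E) (y : F) : HilbertTensor E F := leftSlice F x y

theorem leftSlice_apply (x : E) (y : F) : leftSlice F x y = htmul x y := rfl

theorem rightSlice_apply (x : E) (y : F) : rightSlice E y x = htmul x y := rfl

theorem htmul_def (x : E) (y : F) :
    htmul x y = ((x ⊗ₜ[ℂ] y : E ⊗[ℂ] F) : HilbertTensor E F) := rfl

theorem inner_htmul (x x' : E) (y y' : F) :
    inner ℂ (htmul x y) (htmul x' y') = inner ℂ x x' * inner ℂ y y' := by
  rw [htmul_def, htmul_def, UniformSpace.Completion.inner_coe, TensorProduct.inner_tmul]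

theorem norm_htmul (x : E) (y : F) : ‖htmul x y‖ = ‖x‖ * ‖y‖ := by
  rw [htmul_def, UniformSpace.Completion.norm_coe, TensorProduct.norm_tmul]

theorem htmul_smul_left (c : ℂ) (x : E) (y : F) : htmul (c • x) y = c • htmul x y :=
  (rightSlice E y).map_smul c x

theorem htmul_smul_right (c : ℂ) (x : E) (y : F) : htmul x (c • y) = c • htmul x y :=
  (leftSlice F x).map_smul c y

theorem opTensor_htmul (a : E →L[ℂ] E) (d : F →L[ℂ] F) (x : E) (y : F) :
    opTensor a d (htmul x y) = htmul (a x) (d y) := by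
  rw [htmul_def, opTensor, ContinuousLinearMap.completion_apply_coe, TensorProduct.mapL_tmul,
    htmul_def]

theorem dense_span_htmul {X Y : Type*} {κ : X → E} {κ' : Y → F}
    (hκ : Dense (Submodule.span ℂ (Set.range κ) : Set E))
    (hκ' : Dense (Submodule.span ℂ (Set.range κ') : Set F)) :
    Dense (Submodule.span ℂ (Set.range fun p : X × Y => htmul (κ p.1) (κ' p.2)) :
      Set (HilbertTensor E F)) := by
  set M := (Submodule.span ℂ (Set.range fun p : X × Y => htmul (κ p.1) (κ' p.2))).topologicalClosure
    with hM
  have h1 : ∀ i y, htmul (κ i) y ∈ M := by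
    intro i y
    have : M.comap (leftSlice F (κ i)).toLinearMap = ⊤ := by
      rw [eq_top_iff, ← Submodule.dense_iff_topologicalClosure_eq_top.1 hκ']
      refine Submodule.topologicalClosure_minimal _ (Submodule.span_le.2 ?_) ?_
      · rintro _ ⟨j, rfl⟩
        exact Submodule.le_topologicalClosure _ (Submodule.subset_span ⟨(i, j), rfl⟩)
      · exact (Submodule.isClosed_topologicalClosure _).preimage (leftSlice F (κ i)).continuous
    have h2 : y ∈ M.comap (leftSlice F (κ i)).toLinearMap := by rw [this]; trivial
    exact h2
  have h2 : ∀ x y, htmul x y ∈ M := by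
    intro x y
    have : M.comap (rightSlice E y).toLinearMap = ⊤ := by
      rw [eq_top_iff, ← Submodule.dense_iff_topologicalClosure_eq_top.1 hκ]
      refine Submodule.topologicalClosure_minimal _ (Submodule.span_le.2 ?_) ?_
      · rintro _ ⟨j, rfl⟩
        exact h1 j y
      · exact (Submodule.isClosed_topologicalClosure _).preimage (rightSlice E y).continuous
    have h2 : x ∈ M.comap (rightSlice E y).toLinearMap := by rw [this]; trivial
    exact h2
  rw [Submodule.dense_iff_topologicalClosure_eq_top, ← hM, eq_top_iff]
  have hd : Dense (M : Set (HilbertTensor E F)) := by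
    refine UniformSpace.Completion.denseRange_coe.mono ?_
    rintro _ ⟨z, rfl⟩
    induction z with
    | zero => rw [UniformSpace.Completion.coe_zero]; exact M.zero_mem
    | add x y hx hy => rw [UniformSpace.Completion.coe_add]; exact M.add_mem hx hy
    | tmul x y => exact h2 x y
  rw [← Submodule.dense_iff_topologicalClosure_eq_top.1 hd]
  exact Submodule.topologicalClosure_minimal _ le_rfl (Submodule.isClosed_topologicalClosure _)

theorem dense_span_range_id : Dense (Submodule.span ℂ (Set.range fun x : E => x) : Set E) := by
  simp

theorem dense_htmul : Dense (Submodule.span ℂ (Set.range fun p : E × F => htmul p.1 p.2) :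
      Set (HilbertTensor E F)) :=
  dense_span_htmul (κ := fun x : E => x) (κ' := fun y : F => y) dense_span_range_id
    dense_span_range_id

theorem eq_of_inner_htmul {z w : HilbertTensor E F}
    (h : ∀ x y, inner ℂ z (htmul x y) = inner ℂ w (htmul x y)) : z = w :=
  eq_of_inner_total' dense_htmul fun p => h p.1 p.2

theorem opTensor_ext {T T' : HilbertTensor E F →L[ℂ] HilbertTensor E F}
    (h : ∀ x y, T (htmul x y) = T' (htmul x y)) : T = T' := by
  refine ContinuousLinearMap.ext_on dense_htmul ?_
  rintro _ ⟨p, rfl⟩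
  exact h p.1 p.2

theorem htmul_add_left (x x' : E) (y : F) : htmul (x + x') y = htmul x y + htmul x' y :=
  (rightSlice E y).map_add x x'

theorem htmul_add_right (x : E) (y y' : F) : htmul x (y + y') = htmul x y + htmul x y' :=
  (leftSlice F x).map_add y y'

theorem opTensor_add_left (a a' : E →L[ℂ] E) (d : F →L[ℂ] F) :
    opTensor (a + a') d = opTensor a d + opTensor a' d :=
  opTensor_ext fun x y => by simp [opTensor_htmul, htmul_add_left]

theorem opTensor_add_right (a : E →L[ℂ] E) (d d' : F →L[ℂ] F) :
    opTensor a (d + d') = opTensor a d + opTensor a d' :=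
  opTensor_ext fun x y => by simp [opTensor_htmul, htmul_add_right]

theorem opTensor_smul_left (c : ℂ) (a : E →L[ℂ] E) (d : F →L[ℂ] F) :
    opTensor (c • a) d = c • opTensor a d :=
  opTensor_ext fun x y => by simp [opTensor_htmul, htmul_smul_left]

theorem opTensor_smul_right (c : ℂ) (a : E →L[ℂ] E) (d : F →L[ℂ] F) :
    opTensor a (c • d) = c • opTensor a d :=
  opTensor_ext fun x y => by simp [opTensor_htmul, htmul_smul_right]

theorem opTensor_one : opTensor (1 : E →L[ℂ] E) (1 : F →L[ℂ] F) = 1 :=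
  opTensor_ext fun x y => by simp [opTensor_htmul]

theorem opTensor_comp (a a' : E →L[ℂ] E) (d d' : F →L[ℂ] F) :
    opTensor a d ∘L opTensor a' d' = opTensor (a * a') (d * d') :=
  opTensor_ext fun x y => by simp [opTensor_htmul]

theorem opTensor_opTensor (a a' : E →L[ℂ] E) (d d' : F →L[ℂ] F) (z : HilbertTensor E F) :
    opTensor a d (opTensor a' d' z) = opTensor (a * a') (d * d') z := by
  rw [← opTensor_comp]; rfl

theorem norm_opTensor_le (a : E →L[ℂ] E) (d : F →L[ℂ] F) : ‖opTensor a d‖ ≤ ‖a‖ * ‖d‖ := by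
  refine ContinuousLinearMap.opNorm_le_bound _ (by positivity) fun z => ?_
  induction z using UniformSpace.Completion.induction_on with
  | hp => exact isClosed_le (by fun_prop) (by fun_prop)
  | ih z =>
    rw [opTensor, ContinuousLinearMap.completion_apply_coe, UniformSpace.Completion.norm_coe,
      UniformSpace.Completion.norm_coe]
    exact (ContinuousLinearMap.le_opNorm _ _).trans
      (mul_le_mul_of_nonneg_right (TensorProduct.norm_mapL_le a d) (norm_nonneg _))

variable [CompleteSpace E]

theorem adjoint_rightSlice_htmul (x : E) (y y' : F) :
    ContinuousLinearMap.adjoint (rightSlice E y) (htmul x y') = inner ℂ y y' • x := by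
  refine ext_inner_right ℂ fun x' => ?_
  rw [ContinuousLinearMap.adjoint_inner_left, rightSlice_apply, inner_htmul, inner_smul_left,
    inner_conj_symm, mul_comm]

theorem rightSlice_adjoint_rightSlice (y : F) (z : HilbertTensor E F) :
    rightSlice E y (ContinuousLinearMap.adjoint (rightSlice E y) z) =
      opTensor 1 (InnerProductSpace.rankOne ℂ y y) z := by
  have : rightSlice E y ∘L ContinuousLinearMap.adjoint (rightSlice E y) =
      opTensor 1 (InnerProductSpace.rankOne ℂ y y) := opTensor_ext fun x y' => by
    simp [adjoint_rightSlice_htmul, opTensor_htmul, rightSlice_apply, htmul_smul_right]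
  exact congrArg (fun T => T z) this

variable [CompleteSpace F]

theorem adjoint_opTensor (a : E →L[ℂ] E) (d : F →L[ℂ] F) :
    ContinuousLinearMap.adjoint (opTensor a d) = opTensor (star a) (star d) := by
  refine opTensor_ext fun x y => eq_of_inner_htmul fun x' y' => ?_
  rw [ContinuousLinearMap.adjoint_inner_left, opTensor_htmul, opTensor_htmul, inner_htmul,
    inner_htmul, ContinuousLinearMap.star_eq_adjoint, ContinuousLinearMap.star_eq_adjoint,
    ContinuousLinearMap.adjoint_inner_left, ContinuousLinearMap.adjoint_inner_left]

theorem inner_opTensor_left (a : E →L[ℂ] E) (d : F →L[ℂ] F) (z w : HilbertTensor E F) :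
    inner ℂ (opTensor a d z) w = inner ℂ z (opTensor (star a) (star d) w) := by
  rw [← adjoint_opTensor, ContinuousLinearMap.adjoint_inner_right]

end Tensor

/-! ### `σ`-strong and `σ`-weak convergence -/

section Convergence

open Filter Topology

variable {E F : Type*} [NormedAddCommGroup E] [InnerProductSpace ℂ E]
  [NormedAddCommGroup F] [InnerProductSpace ℂ F]

/-- A bounded net of operators that converges on a total set converges strongly. -/
theorem tendsto_apply_of_total {ι : Type*} {l : Filter ι} {T : ι → E →L[ℂ] F} {T₀ : E →L[ℂ] F}
    {C : ℝ} (hC : ∀ i, ‖T i‖ ≤ C) {s : Set E} (hs : Dense (Submodule.span ℂ s : Set E))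
    (h : ∀ x ∈ s, Tendsto (fun i => T i x) l (𝓝 (T₀ x))) (x : E) :
    Tendsto (fun i => T i x) l (𝓝 (T₀ x)) := by
  have hspan : ∀ y ∈ Submodule.span ℂ s, Tendsto (fun i => T i y) l (𝓝 (T₀ y)) := by
    intro y hy
    induction hy using Submodule.span_induction with
    | mem y hy => exact h y hy
    | zero => simpa using tendsto_const_nhds
    | add y z _ _ hy hz => simpa using hy.add hz
    | smul c y _ hy => simpa using hy.const_smul c
  rw [Metric.tendsto_nhds]
  intro ε hε
  -- The absolute value covers an empty index type, where `C` may be negative; the summand 1 makes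
  -- `M` positive.
  set M : ℝ := |C| + ‖T₀‖ + 1 with hM
  have hMpos : 0 < M := by positivity
  obtain ⟨y, hy, hxy⟩ := Metric.mem_closure_iff.1 (hs x) (ε / (2 * M)) (by positivity)
  filter_upwards [Metric.tendsto_nhds.1 (hspan y hy) (ε / 2) (by positivity)] with i hi
  have h1 : dist (T i x) (T i y) ≤ |C| * dist x y := by
    rw [dist_eq_norm, dist_eq_norm, ← map_sub]
    exact ((T i).le_opNorm _).trans
      (mul_le_mul_of_nonneg_right ((hC i).trans (le_abs_self C)) (norm_nonneg _))
  have h2 : dist (T₀ y) (T₀ x) ≤ ‖T₀‖ * dist x y := by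
    rw [dist_comm, dist_eq_norm, dist_eq_norm, ← map_sub]
    exact T₀.le_opNorm _
  have h3 : M * dist x y < ε / 2 := by
    have := mul_lt_mul_of_pos_left hxy hMpos
    have e : M * (ε / (2 * M)) = ε / 2 := by field_simp
    linarith
  have h4 := dist_triangle4 (T i x) (T i y) (T₀ y) (T₀ x)
  have h5 : (0 : ℝ) ≤ dist x y := dist_nonneg
  have h6 : M * dist x y = |C| * dist x y + ‖T₀‖ * dist x y + dist x y := by rw [hM]; ring
  linarith

theorem ampl_apply (T : E →L[ℂ] F) (ξ : lp (fun _ : ℕ => E) 2) (j : ℕ) :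
    ampl T ξ j = T (ξ j) := rfl

/-- A bounded strongly convergent net converges on square-summable sequences. -/
theorem tendsto_ampl {ι : Type*} {l : Filter ι} {T : ι → E →L[ℂ] F} {T₀ : E →L[ℂ] F}
    {C : ℝ} (hC : ∀ i, ‖T i‖ ≤ C) (h : ∀ x, Tendsto (fun i => T i x) l (𝓝 (T₀ x)))
    (ξ : lp (fun _ : ℕ => E) 2) : Tendsto (fun i => ampl (T i) ξ) l (𝓝 (ampl T₀ ξ)) := by
  have h0 : (0 : ℝ) < (2 : ℝ≥0∞).toReal := by norm_num
  have hs : Summable fun j => ‖ξ j‖ ^ 2 := by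
    simpa using (lp.memℓp ξ).summable h0
  rw [tendsto_iff_norm_sub_tendsto_zero]
  have hsq : Tendsto (fun i => ‖ampl (T i) ξ - ampl T₀ ξ‖ ^ 2) l (𝓝 0) := by
    have e : ∀ i, ‖ampl (T i) ξ - ampl T₀ ξ‖ ^ 2 = ∑' j, ‖T i (ξ j) - T₀ (ξ j)‖ ^ 2 := by
      intro i
      have := lp.norm_rpow_eq_tsum h0 (ampl (T i) ξ - ampl T₀ ξ)
      simpa [ampl_apply] using this
    simp only [e]
    have : Tendsto (fun i => ∑' j, ‖T i (ξ j) - T₀ (ξ j)‖ ^ 2) l (𝓝 (∑' _ : ℕ, (0 : ℝ))) := by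
      refine tendsto_tsum_of_dominated_convergence (bound := fun j => (|C| + ‖T₀‖) ^ 2 * ‖ξ j‖ ^ 2)
        (hs.mul_left _) (fun j => ?_) (Eventually.of_forall fun i j => ?_)
      · have := (tendsto_iff_norm_sub_tendsto_zero.1 (h (ξ j))).pow 2
        simpa using this
      · rw [norm_pow, norm_norm, ← mul_pow]
        refine pow_le_pow_left₀ (norm_nonneg _) ((norm_sub_le _ _).trans ?_) 2
        rw [add_mul]
        exact add_le_add (((T i).le_opNorm _).trans (mul_le_mul_of_nonneg_right
          ((hC i).trans (le_abs_self C)) (norm_nonneg _))) (T₀.le_opNorm _)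
    simpa using this
  have := hsq.sqrt
  simpa [Real.sqrt_sq] using this

theorem tendsto_sigmaStrong_iff {ι : Type*} {l : Filter ι} {T : ι → E →L[ℂ] F} {T₀ : E →L[ℂ] F} :
    Tendsto T l (@nhds _ (sigmaStrong E F) T₀) ↔
      ∀ ξ : lp (fun _ : ℕ => E) 2, Tendsto (fun i => ampl (T i) ξ) l (𝓝 (ampl T₀ ξ)) := by
  rw [nhds_iInf, tendsto_iInf]
  refine forall_congr' fun ξ => ?_
  rw [nhds_induced, tendsto_comap_iff]
  rfl

theorem tendsto_sigmaWeak_iff {ι : Type*} {l : Filter ι} {T : ι → E →L[ℂ] F} {T₀ : E →L[ℂ] F} :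
    Tendsto T l (@nhds _ (sigmaWeak E F) T₀) ↔
      ∀ p : lp (fun _ : ℕ => F) 2 × lp (fun _ : ℕ => E) 2,
        Tendsto (fun i => inner ℂ p.1 (ampl (T i) p.2)) l (𝓝 (inner ℂ p.1 (ampl T₀ p.2))) := by
  rw [nhds_iInf, tendsto_iInf]
  refine forall_congr' fun ξ => ?_
  rw [nhds_induced, tendsto_comap_iff]
  rfl

theorem tendsto_sigmaStrong_of_bounded {ι : Type*} {l : Filter ι} {T : ι → E →L[ℂ] F}
    {T₀ : E →L[ℂ] F} {C : ℝ} (hC : ∀ i, ‖T i‖ ≤ C)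
    (h : ∀ x, Tendsto (fun i => T i x) l (𝓝 (T₀ x))) :
    Tendsto T l (@nhds _ (sigmaStrong E F) T₀) :=
  tendsto_sigmaStrong_iff.2 (tendsto_ampl hC h)

theorem tendsto_sigmaWeak_of_bounded {ι : Type*} {l : Filter ι} {T : ι → E →L[ℂ] F}
    {T₀ : E →L[ℂ] F} {C : ℝ} (hC : ∀ i, ‖T i‖ ≤ C)
    (h : ∀ x, Tendsto (fun i => T i x) l (𝓝 (T₀ x))) :
    Tendsto T l (@nhds _ (sigmaWeak E F) T₀) :=
  tendsto_sigmaWeak_iff.2 fun p => tendsto_const_nhds.inner (tendsto_ampl hC h p.2)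

/-- `σ`-weak convergence implies convergence of matrix coefficients. -/
theorem tendsto_inner_of_sigmaWeak {ι : Type*} {l : Filter ι} {T : ι → E →L[ℂ] F}
    {T₀ : E →L[ℂ] F} (h : Tendsto T l (@nhds _ (sigmaWeak E F) T₀)) (η : F) (ξ : E) :
    Tendsto (fun i => inner ℂ η (T i ξ)) l (𝓝 (inner ℂ η (T₀ ξ))) := by
  have := tendsto_sigmaWeak_iff.1 h (lp.single 2 0 η, lp.single 2 0 ξ)
  simpa [lp.inner_single_left, ampl_apply] using this

theorem continuous_inner_ampl (p : lp (fun _ : ℕ => F) 2 × lp (fun _ : ℕ => E) 2) :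
    @Continuous _ _ (sigmaWeak E F) _ fun T : E →L[ℂ] F => inner ℂ p.1 (ampl T p.2) :=
  continuous_iInf_dom continuous_induced_dom

theorem continuous_sigmaWeak_rng {X : Type*} {τ : TopologicalSpace X} {f : X → E →L[ℂ] F}
    (h : ∀ p : lp (fun _ : ℕ => F) 2 × lp (fun _ : ℕ => E) 2,
      Continuous fun x => inner ℂ p.1 (ampl (f x) p.2)) :
    @Continuous _ _ τ (sigmaWeak E F) f :=
  continuous_iInf_rng.2 fun p => continuous_induced_rng.2 (h p)

/-- The `σ`-weak seminorms use sequences over ℕ; this moves a family over any index set to ℕ once a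
relevant part of that set is enumerated. -/
theorem exists_lp_extend {W : Type*} [NormedAddCommGroup W] {ι : Type*} {s : Set ι}
    {e : s → ℕ} (he : Function.Injective e) {f : ι → W} (hf : Summable fun i => ‖f i‖ ^ 2) :
    ∃ A : lp (fun _ : ℕ => W) 2, ∀ n, A n = Function.extend e (fun i : s => f i) 0 n := by
  have h1 : (fun n => ‖Function.extend e (fun i : s => f i) 0 n‖ ^ 2) =
      Function.extend e (fun i : s => ‖f i‖ ^ 2) 0 := by
    funext n
    by_cases hn : ∃ i, e i = n
    · obtain ⟨i, rfl⟩ := hn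
      rw [he.extend_apply, he.extend_apply]
    · rw [Function.extend_apply' _ _ _ hn, Function.extend_apply' _ _ _ hn]
      simp
  have h2 : Summable fun n => ‖Function.extend e (fun i : s => f i) 0 n‖ ^ 2 := by
    rw [h1]
    exact (summable_extend_zero he).2 (hf.subtype s)
  exact ⟨⟨Function.extend e (fun i : s => f i) 0, memℓp_gen (by simpa using h2)⟩, fun n => rfl⟩

/-- A functional `b ↦ ∑ ⟪a i, b (c i)⟫` given by square-summable families is `σ`-weakly
continuous. -/
theorem continuous_tsum_inner {ι : Type*} {a : ι → F} {c : ι → E}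
    (ha : Summable fun i => ‖a i‖ ^ 2) (hc : Summable fun i => ‖c i‖ ^ 2) :
    @Continuous _ _ (sigmaWeak E F) _ fun b : E →L[ℂ] F => ∑' i, inner ℂ (a i) (b (c i)) := by
  -- The support of `a` alone suffices: off it every term vanishes, whatever `c` is.
  let s : Set ι := Function.support fun i => ‖a i‖ ^ 2
  have hs : s.Countable := ha.countable_support
  obtain ⟨e, he⟩ := Set.countable_iff_exists_injective.1 hs
  obtain ⟨A, hA⟩ := exists_lp_extend he ha
  obtain ⟨B, hB⟩ := exists_lp_extend he hc
  have key : (fun b : E →L[ℂ] F => ∑' i, inner ℂ (a i) (b (c i))) =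
      fun b => inner ℂ A (ampl b B) := by
    funext b
    rw [lp.inner_eq_tsum]
    have h1 : (fun n => inner ℂ (A n) (ampl b B n)) =
        Function.extend e (fun i : s => inner ℂ (a i) (b (c i))) 0 := by
      funext n
      rw [ampl_apply, hA, hB]
      by_cases hn : ∃ i, e i = n
      · obtain ⟨i, rfl⟩ := hn
        simp only [he.extend_apply]
      · simp only [Function.extend_apply' _ _ _ hn]
        simp
    rw [h1, tsum_extend_zero he, tsum_subtype s (fun i => inner ℂ (a i) (b (c i)))]
    refine tsum_congr fun i => ?_
    by_cases hi : i ∈ s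
    · rw [Set.indicator_of_mem hi]
    · rw [Set.indicator_of_notMem hi]
      have : a i = 0 := by simpa [s] using hi
      simp [this]
  rw [key]
  exact continuous_inner_ampl (A, B)

end Convergence

/-! ### Finite-rank projections along an orthonormal basis -/

section Basis

open Filter Topology

variable {E : Type*} [NormedAddCommGroup E] [InnerProductSpace ℂ E] {ι : Type*}

/-- The orthogonal projection onto the span of finitely many basis vectors. -/
def basisProj (e : HilbertBasis ι ℂ E) (s : Finset ι) : E →L[ℂ] E :=
  ∑ i ∈ s, InnerProductSpace.rankOne ℂ (e i) (e i)

theorem basisProj_apply (e : HilbertBasis ι ℂ E) (s : Finset ι) (x : E) :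
    basisProj e s x = ∑ i ∈ s, inner ℂ (e i) x • e i := by
  simp [basisProj]

theorem norm_basisProj_le (e : HilbertBasis ι ℂ E) (s : Finset ι) : ‖basisProj e s‖ ≤ 1 := by
  refine ContinuousLinearMap.opNorm_le_bound _ zero_le_one fun x => ?_
  rw [one_mul]
  refine le_of_sq_le_sq ?_ (norm_nonneg _)
  have h1 := e.orthonormal.sum_inner_products_le x (s := s)
  have h2 : ‖basisProj e s x‖ ^ 2 = ∑ i ∈ s, ‖inner ℂ (e i) x‖ ^ 2 := by
    rw [← inner_self_eq_norm_sq (𝕜 := ℂ), basisProj_apply, e.orthonormal.inner_sum, map_sum]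
    refine Finset.sum_congr rfl fun i _ => ?_
    rw [RCLike.conj_mul]
    norm_cast
  rw [h2]
  exact h1

theorem tendsto_basisProj (e : HilbertBasis ι ℂ E) (x : E) :
    Tendsto (fun s => basisProj e s x) atTop (𝓝 x) := by
  have := e.hasSum_repr x
  simp only [HilbertBasis.repr_apply_apply] at this
  simp only [basisProj_apply]
  exact this

end Basis

/-! ### A criterion for `σ`-strong density -/

section Density

open Filter Topology

variable {H E : Type*} [NormedAddCommGroup H] [InnerProductSpace ℂ H] [CompleteSpace H]
  [NormedAddCommGroup E] [InnerProductSpace ℂ E]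

/-- A subspace `M` of `L(H; E)` that is stable under right multiplication by rank-one operators and
whose ranges span a dense subspace is `σ`-strongly dense. -/
theorem sigmaStrong_dense (M : Submodule ℂ (H →L[ℂ] E))
    (hM : ∀ T ∈ M, ∀ ξ η : H, InnerProductSpace.rankOne ℂ (T ξ) η ∈ M)
    (hd : Dense (Submodule.span ℂ {x : E | ∃ T ∈ M, ∃ ξ : H, x = T ξ} : Set E)) :
    @Dense _ (sigmaStrong H E) (M : Set (H →L[ℂ] E)) := by
  have h1 : ∀ x ∈ Submodule.span ℂ {x : E | ∃ T ∈ M, ∃ ξ : H, x = T ξ}, ∀ η : H,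
      InnerProductSpace.rankOne ℂ x η ∈ M := by
    intro x hx η
    induction hx using Submodule.span_induction with
    | mem x hx => obtain ⟨T, hT, ξ, rfl⟩ := hx; exact hM T hT ξ η
    | zero => simp
    | add x y _ _ hx hy => rw [map_add]; exact M.add_mem hx hy
    | smul c x _ hx => rw [map_smul]; exact M.smul_mem c hx
  have h2 : ∀ (x : E) (η : H), InnerProductSpace.rankOne ℂ x η ∈ M.topologicalClosure := by
    intro x η
    have hc : Continuous fun x : E => (InnerProductSpace.rankOne ℂ x η : H →L[ℂ] E) := by fun_prop
    exact map_mem_closure (f := fun x : E => (InnerProductSpace.rankOne ℂ x η : H →L[ℂ] E))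
      (t := (M : Set (H →L[ℂ] E))) hc (hd x) fun y hy => h1 y hy η
  obtain ⟨w, e, -⟩ := exists_hilbertBasis ℂ H
  intro T
  have h3 : ∀ s, T ∘L basisProj e s ∈ M.topologicalClosure := by
    intro s
    have : T ∘L basisProj e s = ∑ i ∈ s, InnerProductSpace.rankOne ℂ (T (e i)) (e i) := by
      ext x
      simp [basisProj_apply]
    rw [this]
    exact Submodule.sum_mem _ fun i _ => h2 _ _
  have h4 : (M.topologicalClosure : Set (H →L[ℂ] E)) ⊆
      @closure _ (sigmaStrong H E) (M : Set (H →L[ℂ] E)) := by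
    intro T hT
    -- Norm-closure points are limits of sequences, which are bounded, so strong convergence
    -- upgrades to `σ`-strong convergence.
    obtain ⟨x, hx, hxT⟩ := mem_closure_iff_seq_limit.1 hT
    obtain ⟨C, hC⟩ := hxT.norm.bddAbove_range
    have h5 : Tendsto x atTop (@nhds _ (sigmaStrong H E) T) := by
      refine tendsto_sigmaStrong_of_bounded (C := C) (fun i => hC ⟨i, rfl⟩) fun y => ?_
      exact ((ContinuousLinearMap.apply ℂ E y).continuous.tendsto T).comp hxT
    exact @mem_closure_of_tendsto _ (sigmaStrong H E) _ _ _ _ _ _ h5 (Eventually.of_forall hx)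
  have h5 : Tendsto (fun s => T ∘L basisProj e s) atTop (@nhds _ (sigmaStrong H E) T) := by
    refine tendsto_sigmaStrong_of_bounded (C := ‖T‖) (fun s => ?_) fun x => ?_
    · refine (ContinuousLinearMap.opNorm_comp_le _ _).trans ?_
      exact mul_le_of_le_one_right (norm_nonneg _) (norm_basisProj_le e s)
    · exact (T.continuous.tendsto x).comp (tendsto_basisProj e x)
  rw [← @closure_closure _ (sigmaStrong H E)]
  exact @mem_closure_of_tendsto _ (sigmaStrong H E) _ _ _ _ _ _ h5 (Eventually.of_forall fun s => h4 (h3 s))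

end Density

/-! ### Components along a basis of the second factor, and normality of compressions -/

section Slices

open Filter Topology

variable {E F : Type*} [NormedAddCommGroup E] [InnerProductSpace ℂ E]
  [NormedAddCommGroup F] [InnerProductSpace ℂ F] {ι : Type*}

theorem tendsto_opTensor_basisProj (f : HilbertBasis ι ℂ F) (z : HilbertTensor E F) :
    Tendsto (fun s => opTensor (1 : E →L[ℂ] E) (basisProj f s) z) atTop (𝓝 z) := by
  refine tendsto_apply_of_total (T₀ := 1) (C := ‖(1 : E →L[ℂ] E)‖ * 1) (fun s => ?_) dense_htmul ?_ z
  · exact (norm_opTensor_le _ _).trans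
      (mul_le_mul_of_nonneg_left (norm_basisProj_le f s) (norm_nonneg _))
  · rintro _ ⟨⟨x, y⟩, rfl⟩
    simp only [opTensor_htmul]
    exact ((leftSlice F x).continuous.tendsto y).comp (tendsto_basisProj f y)

variable [CompleteSpace E]

theorem opTensor_basisProj (f : HilbertBasis ι ℂ F) (s : Finset ι) (z : HilbertTensor E F) :
    opTensor (1 : E →L[ℂ] E) (basisProj f s) z =
      ∑ i ∈ s, rightSlice E (f i) (ContinuousLinearMap.adjoint (rightSlice E (f i)) z) := by
  simp only [rightSlice_adjoint_rightSlice]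
  have : opTensor (1 : E →L[ℂ] E) (basisProj f s) =
      ∑ i ∈ s, opTensor (1 : E →L[ℂ] E) (InnerProductSpace.rankOne ℂ (f i) (f i)) :=
    opTensor_ext fun x y => by
      simp only [opTensor_htmul, sum_apply, basisProj]
      exact map_sum (leftSlice F x) _ _
  rw [this, sum_apply]

/-- A vector of the tensor product is the sum of its components along a basis of the second
factor. -/
theorem hasSum_rightSlice (f : HilbertBasis ι ℂ F) (z : HilbertTensor E F) :
    HasSum (fun i => rightSlice E (f i) (ContinuousLinearMap.adjoint (rightSlice E (f i)) z)) z := by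
  have := tendsto_opTensor_basisProj (E := E) f z
  simp only [opTensor_basisProj] at this
  exact this

theorem hasSum_inner_rightSlice (f : HilbertBasis ι ℂ F) (w z : HilbertTensor E F) :
    HasSum (fun i => inner ℂ (ContinuousLinearMap.adjoint (rightSlice E (f i)) w)
      (ContinuousLinearMap.adjoint (rightSlice E (f i)) z)) (inner ℂ w z) := by
  have := (hasSum_rightSlice f z).mapL (innerSL ℂ w)
  simpa only [innerSL_apply_apply, ContinuousLinearMap.adjoint_inner_left] using this

theorem hasSum_norm_sq_rightSlice (f : HilbertBasis ι ℂ F) (z : HilbertTensor E F) :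
    HasSum (fun i => ‖ContinuousLinearMap.adjoint (rightSlice E (f i)) z‖ ^ 2) (‖z‖ ^ 2) := by
  have := (hasSum_inner_rightSlice f z z).mapL Complex.reCLM
  simpa only [Complex.reCLM_apply, ← RCLike.re_eq_complex_re, inner_self_eq_norm_sq] using this

variable [CompleteSpace F]

theorem adjoint_rightSlice_opTensor (y : F) (b : E →L[ℂ] E) (z : HilbertTensor E F) :
    ContinuousLinearMap.adjoint (rightSlice E y) (opTensor b 1 z) =
      b (ContinuousLinearMap.adjoint (rightSlice E y) z) := by
  refine ext_inner_right ℂ fun x => ?_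
  rw [ContinuousLinearMap.adjoint_inner_left, inner_opTensor_left,
    rightSlice_apply, opTensor_htmul, ← ContinuousLinearMap.adjoint_inner_right b,
    ContinuousLinearMap.adjoint_inner_left, rightSlice_apply, star_one,
    one_apply_eq_self, ContinuousLinearMap.star_eq_adjoint]

/-- The compression `b ↦ T* (b ⊗ d) T'` is normal. -/
theorem continuous_compression {H : Type*} [NormedAddCommGroup H] [InnerProductSpace ℂ H]
    [CompleteSpace H] (T T' : H →L[ℂ] HilbertTensor E F) (d : F →L[ℂ] F) :
    @Continuous _ _ (sigmaWeak E E) (sigmaWeak H H)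
      fun b : E →L[ℂ] E => ContinuousLinearMap.adjoint T ∘L opTensor b d ∘L T' := by
  obtain ⟨w, f, -⟩ := exists_hilbertBasis ℂ F
  refine @continuous_sigmaWeak_rng _ _ _ _ _ _ _ (sigmaWeak E E) _ fun p => ?_
  have h0 : (0 : ℝ) < (2 : ℝ≥0∞).toReal := by norm_num
  have hsum : ∀ z : lp (fun _ : ℕ => HilbertTensor E F) 2,
      Summable fun q : ℕ × w =>
        ‖ContinuousLinearMap.adjoint (rightSlice E (f q.2)) (z q.1)‖ ^ 2 := by
    intro z
    rw [summable_prod_of_nonneg fun q => by positivity]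
    refine ⟨fun j => (hasSum_norm_sq_rightSlice f (z j)).summable, ?_⟩
    simp only [(hasSum_norm_sq_rightSlice f (z _)).tsum_eq]
    simpa using (lp.memℓp z).summable h0
  -- Write b ⊗ d = (b ⊗ 1)(1 ⊗ d) and slice along the basis of `F`: `b` then acts only between two
  -- fixed families over `ℕ × w`, square-summable by Parseval.
  have key : (fun b : E →L[ℂ] E => inner ℂ p.1
      (ampl (ContinuousLinearMap.adjoint T ∘L opTensor b d ∘L T') p.2)) = fun b => ∑' q : ℕ × w,
        inner ℂ (ContinuousLinearMap.adjoint (rightSlice E (f q.2)) (ampl T p.1 q.1))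
          (b (ContinuousLinearMap.adjoint (rightSlice E (f q.2))
            (ampl (opTensor 1 d ∘L T') p.2 q.1))) := by
    funext b
    have hs : Summable fun q : ℕ × w =>
        inner ℂ (ContinuousLinearMap.adjoint (rightSlice E (f q.2)) (ampl T p.1 q.1))
          (b (ContinuousLinearMap.adjoint (rightSlice E (f q.2))
            (ampl (opTensor 1 d ∘L T') p.2 q.1))) := by
      refine Summable.of_norm_bounded
        ((hsum (ampl T p.1)).add (hsum (ampl (opTensor b d ∘L T') p.2))) fun q => ?_
      have hb : b (ContinuousLinearMap.adjoint (rightSlice E (f q.2))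
          (ampl (opTensor 1 d ∘L T') p.2 q.1)) = ContinuousLinearMap.adjoint
            (rightSlice E (f q.2)) (ampl (opTensor b d ∘L T') p.2 q.1) := by
        rw [← adjoint_rightSlice_opTensor]
        simp [ampl_apply, opTensor_opTensor]
      rw [hb]
      refine (norm_inner_le_norm _ _).trans ?_
      nlinarith [sq_nonneg (‖ContinuousLinearMap.adjoint (rightSlice E (f q.2)) (ampl T p.1 q.1)‖ -
        ‖ContinuousLinearMap.adjoint (rightSlice E (f q.2))
          (ampl (opTensor b d ∘L T') p.2 q.1)‖), sq_nonneg
          ‖ContinuousLinearMap.adjoint (rightSlice E (f q.2)) (ampl T p.1 q.1)‖, sq_nonneg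
          ‖ContinuousLinearMap.adjoint (rightSlice E (f q.2))
          (ampl (opTensor b d ∘L T') p.2 q.1)‖]
    rw [hs.tsum_prod, lp.inner_eq_tsum]
    refine tsum_congr fun j => ?_
    rw [ampl_apply, ContinuousLinearMap.comp_apply, ContinuousLinearMap.adjoint_inner_right]
    refine ((hasSum_inner_rightSlice f _ _).congr_fun fun i => ?_).tsum_eq.symm
    rw [← adjoint_rightSlice_opTensor]
    simp [ampl_apply, opTensor_opTensor]
  rw [key]
  exact continuous_tsum_inner (hsum (ampl T p.1)) (hsum (ampl (opTensor 1 d ∘L T') p.2))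

end Slices

/-! ### Sesquilinear forms and polarization -/

section Sesq

variable {H V : Type*} [NormedAddCommGroup H] [InnerProductSpace ℂ H] [CompleteSpace H]
  [AddCommGroup V] [Module ℂ V] [Module (H →L[ℂ] H)ᵐᵒᵖ V] {s : V → V → (H →L[ℂ] H)}

namespace IsSesqForm

theorem add_right (hs : IsSesqForm s) (u v w : V) : s u (v + w) = s u v + s u w := by
  simpa using hs.add_smul_right u v w 1

theorem add_left (hs : IsSesqForm s) (u v w : V) : s (v + w) u = s v u + s w u := by
  simpa using hs.add_smul_left u v w 1

theorem zero_right (hs : IsSesqForm s) (u : V) : s u 0 = 0 := by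
  simpa using hs.add_right u 0 0

theorem zero_left (hs : IsSesqForm s) (u : V) : s 0 u = 0 := by
  simpa using hs.add_left u 0 0

theorem smul_right (hs : IsSesqForm s) (u v : V) (c : ℂ) : s u (c • v) = c • s u v := by
  simpa [hs.zero_right] using hs.add_smul_right u 0 v c

theorem smul_left (hs : IsSesqForm s) (u v : V) (c : ℂ) : s (c • v) u = star c • s v u := by
  simpa [hs.zero_left] using hs.add_smul_left u 0 v c

/-- Needed because normality and the extremality condition only speak of the diagonal. -/
theorem polarization (hs : IsSesqForm s) (v w : V) :
    s v w = (1 / 4 : ℂ) • (s (v + (1 : ℂ) • w) (v + (1 : ℂ) • w)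
      - s (v + (-1 : ℂ) • w) (v + (-1 : ℂ) • w)
      - Complex.I • s (v + Complex.I • w) (v + Complex.I • w)
      + Complex.I • s (v + (-Complex.I) • w) (v + (-Complex.I) • w)) := by
  simp only [hs.add_smul_left, hs.add_smul_right, smul_add, smul_sub, smul_smul, star_neg, star_one,
    RCLike.star_def, Complex.conj_I]
  match_scalars <;> (ring_nf; try simp [Complex.I_sq]; try norm_num)

end IsSesqForm

end Sesq

/-! ### The scalar kernel of a completely positive map -/

section Kernel

open scoped ComplexConjugate
open Filter Topology

variable {H : Type*} [NormedAddCommGroup H] [InnerProductSpace ℂ H] [CompleteSpace H]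
  {K : Type*} [NormedAddCommGroup K] [InnerProductSpace ℂ K] [CompleteSpace K]
  {V : Type*} [AddCommGroup V] [Module ℂ V] [Module (H →L[ℂ] H)ᵐᵒᵖ V]
  {S : (K →L[ℂ] K) →ₗ[ℂ] (V → V → (H →L[ℂ] H))}

/-- The scalar kernel `⟪ξ, S_{|x⟩⟨y|}(v, w) η⟫`. -/
def cpKernel (S : (K →L[ℂ] K) →ₗ[ℂ] (V → V → (H →L[ℂ] H))) (p q : V × K × H) : ℂ :=
  inner ℂ p.2.2 (S (InnerProductSpace.rankOne ℂ p.2.1 q.2.1) p.1 q.1 q.2.2)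

theorem IsCP.isPositive_sum {ι : Type*} [Fintype ι] (hcp : IsCP S) (b : ι → (K →L[ℂ] K))
    (v : ι → V) : (∑ j, ∑ k, S (star (b j) * b k) (v j) (v k)).IsPositive := by
  have h := hcp (Fintype.card ι) (fun i => b ((Fintype.equivFin ι).symm i))
    (fun i => v ((Fintype.equivFin ι).symm i))
  have e : ∑ j, ∑ k, S (star (b j) * b k) (v j) (v k) = ∑ j, ∑ k,
      S (star (b ((Fintype.equivFin ι).symm j)) * b ((Fintype.equivFin ι).symm k))
        (v ((Fintype.equivFin ι).symm j)) (v ((Fintype.equivFin ι).symm k)) := by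
    rw [← Equiv.sum_comp (Fintype.equivFin ι).symm]
    exact Finset.sum_congr rfl fun j _ => (Equiv.sum_comp (Fintype.equivFin ι).symm _).symm
  rwa [e]

theorem IsCP.isPositive_star_mul (hcp : IsCP S) (b : K →L[ℂ] K) (v : V) :
    (S (star b * b) v v).IsPositive := by
  simpa using hcp 1 (fun _ => b) fun _ => v

/-- Positivity for the pair `(b, 1)`, `(v, w)` makes the off-diagonal sum S_{b*}(v,w) + S_b(w,v)
self-adjoint; replacing v by iv separates the two terms. -/
theorem IsCP.apply_star (hs : ∀ b, IsSesqForm (S b)) (hcp : IsCP S) (b : K →L[ℂ] K) (v w : V) :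
    S (star b) v w = star (S b w v) := by
  have key : ∀ v : V, star (S (star b) v w + S b w v) = S (star b) v w + S b w v := by
    intro v
    have h := (hcp 2 ![b, 1] ![v, w]).isSelfAdjoint
    have h1 := (hcp.isPositive_star_mul b v).isSelfAdjoint
    have h2 := (hcp.isPositive_star_mul 1 w).isSelfAdjoint
    simp only [Fin.sum_univ_two, Matrix.cons_val_zero, Matrix.cons_val_one, star_one, one_mul,
      mul_one] at h h2
    have h3 := (h.sub h1).sub h2
    have e : S (star b * b) v v + S (star b) v w + (S b w v + S 1 w w) - S (star b * b) v v
        - S 1 w w = S (star b) v w + S b w v := by abel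
    rw [e] at h3
    exact h3
  have k1 := key v
  have k2 := key (Complex.I • v)
  rw [(hs _).smul_left, (hs _).smul_right] at k2
  simp only [star_add, star_smul, RCLike.star_def, Complex.conj_I, Complex.conj_neg_I] at k1 k2
  have k3 := congrArg (fun T => Complex.I • T) k2
  simp only [smul_add, smul_smul, smul_neg, Complex.I_mul_I, neg_neg, one_smul, neg_smul] at k3
  have k4 : (2 : ℂ) • S (star b) v w = (2 : ℂ) • star (S b w v) := by
    rw [two_smul, two_smul]
    calc S (star b) v w + S (star b) v w
        = (S (star b) v w + S b w v) + (S (star b) v w + -S b w v) := by abel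
      _ = star (S b w v) + star (S b w v) := by rw [← k1, ← k3]; abel
  exact smul_right_injective _ two_ne_zero k4

theorem cpKernel_conj (hs : ∀ b, IsSesqForm (S b)) (hcp : IsCP S) (p q : V × K × H) :
    conj (cpKernel S p q) = cpKernel S q p := by
  have e : InnerProductSpace.rankOne ℂ q.2.1 p.2.1 =
      star (InnerProductSpace.rankOne ℂ p.2.1 q.2.1) := by
    rw [ContinuousLinearMap.star_eq_adjoint, InnerProductSpace.adjoint_rankOne]
  rw [cpKernel, cpKernel, e, hcp.apply_star hs, inner_conj_symm,
    ContinuousLinearMap.star_eq_adjoint, ContinuousLinearMap.adjoint_inner_right]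

/-- Complete positivity in terms of vectors. -/
theorem IsCP.re_sum_inner_nonneg {ι : Type*} [Fintype ι] (hs : ∀ b, IsSesqForm (S b))
    (hcp : IsCP S) (b : ι → (K →L[ℂ] K)) (v : ι → V) (ξ : ι → H) :
    0 ≤ (∑ j, ∑ k, inner ℂ (ξ j) (S (star (b j) * b k) (v j) (v k) (ξ k))).re := by
  rcases subsingleton_or_nontrivial H with hH | hH
  · simp [Subsingleton.elim (ξ _) 0]
  -- Replacing v_j by v_j |ξ_j⟩⟨h₀| and testing positivity at the single vector h₀ produces the
  -- distinct vectors ξ_j.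
  obtain ⟨h₀, hh₀⟩ := exists_norm_eq H zero_le_one
  have h := (hcp.isPositive_sum b
    fun j => MulOpposite.op (InnerProductSpace.rankOne ℂ (ξ j) h₀) • v j).re_inner_nonneg_right h₀
  have hr : ∀ j, InnerProductSpace.rankOne ℂ (ξ j) h₀ h₀ = ξ j := fun j => by
    simp [hh₀]
  simpa only [(hs _).op_left, (hs _).op_right, sum_apply, inner_sum,
    mul_apply_eq_comp, hr, ContinuousLinearMap.star_eq_adjoint,
    ContinuousLinearMap.adjoint_inner_right, mul_assoc, RCLike.re_eq_complex_re] using h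

theorem cpKernel_pos (hs : ∀ b, IsSesqForm (S b)) (hcp : IsCP S) (f : (V × K × H) →₀ ℂ) :
    0 ≤ (f.sum fun p c => f.sum fun q d => conj c * d * cpKernel S p q).re := by
  rcases subsingleton_or_nontrivial K with hK | hK
  · have : ∀ p q : V × K × H, cpKernel S p q = 0 := fun p q => by
      rw [cpKernel, Subsingleton.elim (InnerProductSpace.rankOne ℂ p.2.1 q.2.1) 0]
      simp
    simp [this]
  obtain ⟨e₀, he₀⟩ := exists_norm_eq K zero_le_one
  have h := hcp.re_sum_inner_nonneg hs
    (fun p : f.support => InnerProductSpace.rankOne ℂ e₀ p.1.2.1) (fun p => p.1.1)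
    (fun p => f p.1 • p.1.2.2)
  have e : ∀ x y : K, star (InnerProductSpace.rankOne ℂ e₀ x) * InnerProductSpace.rankOne ℂ e₀ y =
      InnerProductSpace.rankOne ℂ x y := fun x y => by
    rw [ContinuousLinearMap.star_eq_adjoint, InnerProductSpace.adjoint_rankOne,
      ContinuousLinearMap.mul_def, InnerProductSpace.rankOne_comp_rankOne]
    simp [he₀]
  simp only [e, map_smul, inner_smul_left, inner_smul_right] at h
  have e2 : (f.sum fun p c => f.sum fun q d => conj c * d * cpKernel S p q) =
      ∑ p : f.support, ∑ q : f.support, conj (f p.1) * (f q.1 * cpKernel S p.1 q.1) := by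
    rw [Finsupp.sum, ← Finset.sum_coe_sort]
    refine Finset.sum_congr rfl fun p _ => ?_
    rw [Finsupp.sum, ← Finset.sum_coe_sort]
    exact Finset.sum_congr rfl fun q _ => mul_assoc _ _ _
  rw [e2]
  simpa only [cpKernel, mul_left_comm] using h

/-- The bounded net b P_s converges strongly, hence `σ`-weakly, to b. With `hasSum_cpKernel` this
shows that a normal `S` is determined by its values on rank-one operators. -/
theorem IsNormal.tendsto_apply {ι : Type*} (hs : ∀ b, IsSesqForm (S b)) (hn : IsNormal S)
    (e : HilbertBasis ι ℂ K) (b : K →L[ℂ] K) (v w : V) (ξ η : H) :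
    Tendsto (fun s : Finset ι => inner ℂ ξ (S (b * basisProj e s) v w η)) atTop
      (𝓝 (inner ℂ ξ (S b v w η))) := by
  have h1 : Tendsto (fun s => b * basisProj e s) atTop (@nhds _ (sigmaWeak K K) b) := by
    refine tendsto_sigmaWeak_of_bounded (C := ‖b‖) (fun s => ?_) fun x => ?_
    · refine (norm_mul_le _ _).trans ?_
      exact mul_le_of_le_one_right (norm_nonneg _) (norm_basisProj_le e s)
    · exact (b.continuous.tendsto x).comp (tendsto_basisProj e x)
  have h2 : ∀ v, Tendsto (fun s => inner ℂ ξ (S (b * basisProj e s) v v η)) atTop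
      (𝓝 (inner ℂ ξ (S b v v η))) := fun v =>
    tendsto_inner_of_sigmaWeak ((@Continuous.tendsto _ _ (sigmaWeak K K) (sigmaWeak H H) _
      (hn v) b).comp h1) ξ η
  simp only [fun b => (hs b).polarization v w, smul_apply, add_apply, sub_apply,
    inner_smul_right, inner_add_right, inner_sub_right]
  exact (((((h2 _).sub (h2 _)).sub ((h2 _).const_mul _)).add ((h2 _).const_mul _)).const_mul _)

theorem IsNormal.hasSum_cpKernel {ι : Type*} (hs : ∀ b, IsSesqForm (S b)) (hn : IsNormal S)
    (e : HilbertBasis ι ℂ K) (b : K →L[ℂ] K) (v w : V) (ξ η : H) :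
    HasSum (fun i => cpKernel S (v, b (e i), ξ) (w, e i, η)) (inner ℂ ξ (S b v w η)) := by
  have := hn.tendsto_apply hs e b v w ξ η
  have h : ∀ s : Finset ι, inner ℂ ξ (S (b * basisProj e s) v w η) =
      ∑ i ∈ s, cpKernel S (v, b (e i), ξ) (w, e i, η) := by
    intro s
    have h1 : b * basisProj e s = ∑ i ∈ s, InnerProductSpace.rankOne ℂ (b (e i)) (e i) := by
      rw [basisProj, Finset.mul_sum]
      exact Finset.sum_congr rfl fun i _ => InnerProductSpace.comp_rankOne _ _ _
    simp only [h1, map_sum, Finset.sum_apply, sum_apply, inner_sum, cpKernel]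
  simp only [h] at this
  exact this

end Kernel

/-! ### Construction of the dilation from a Gram family -/

section Gram

open scoped ComplexConjugate
open Filter Topology

variable {H : Type*} [NormedAddCommGroup H] [InnerProductSpace ℂ H] [CompleteSpace H]
  {K : Type*} [NormedAddCommGroup K] [InnerProductSpace ℂ K] [CompleteSpace K]
  {V : Type*} [AddCommGroup V] [Module ℂ V] [Module (H →L[ℂ] H)ᵐᵒᵖ V]
  {S : (K →L[ℂ] K) →ₗ[ℂ] (V → V → (H →L[ℂ] H))}
  {K' : Type*} [NormedAddCommGroup K'] [InnerProductSpace ℂ K'] [CompleteSpace K']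

/-- `κ` is a total family in `K'` with Gram kernel `cpKernel S`. -/
structure IsGramFamily (S : (K →L[ℂ] K) →ₗ[ℂ] (V → V → (H →L[ℂ] H))) (κ : V × K × H → K') :
    Prop where
  inner_eq : ∀ p q, inner ℂ (κ p) (κ q) = cpKernel S p q
  dense : Dense (Submodule.span ℂ (Set.range κ) : Set K')

namespace IsGramFamily

variable {κ : V × K × H → K'}

theorem add_smul_module (hκ : IsGramFamily S κ) (hs : ∀ b, IsSesqForm (S b)) (v w : V) (c : ℂ)
    (x : K) (ξ : H) : κ (v + c • w, x, ξ) = κ (v, x, ξ) + c • κ (w, x, ξ) :=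
  eq_of_inner_total hκ.dense fun q => by
    simp [hκ.inner_eq, cpKernel, (hs _).add_smul_right]

theorem add_smul_right (hκ : IsGramFamily S κ) (v : V) (c : ℂ)
    (x : K) (ξ η : H) : κ (v, x, ξ + c • η) = κ (v, x, ξ) + c • κ (v, x, η) :=
  eq_of_inner_total hκ.dense fun q => by
    simp [hκ.inner_eq, cpKernel]

/-- Rank-one operators are antilinear in their second vector. This makes x ↦ ⟪κ(v,x,ξ), y⟫ linear,
as a pairing with x ⊗ y must be. -/
theorem add_smul_left (hκ : IsGramFamily S κ) (v : V) (c : ℂ)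
    (x y : K) (ξ : H) : κ (v, x + c • y, ξ) = κ (v, x, ξ) + conj c • κ (v, y, ξ) :=
  eq_of_inner_total hκ.dense fun q => by
    simp [hκ.inner_eq, cpKernel]

theorem zero_left (hκ : IsGramFamily S κ) (v : V) (ξ : H) : κ (v, 0, ξ) = 0 :=
  eq_of_inner_total hκ.dense fun q => by simp [hκ.inner_eq, cpKernel]

theorem smul_left (hκ : IsGramFamily S κ) (v : V) (c : ℂ) (x : K) (ξ : H) :
    κ (v, c • x, ξ) = conj c • κ (v, x, ξ) := by
  simpa [hκ.zero_left] using hκ.add_smul_left v c 0 x ξ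

theorem op_smul (hκ : IsGramFamily S κ) (hs : ∀ b, IsSesqForm (S b)) (v : V) (a : H →L[ℂ] H)
    (x : K) (ξ : H) : κ (MulOpposite.op a • v, x, ξ) = κ (v, x, a ξ) :=
  eq_of_inner_total hκ.dense fun q => by
    simp [hκ.inner_eq, cpKernel, (hs _).op_right]

theorem norm_sq (hκ : IsGramFamily S κ) (p : V × K × H) : ‖κ p‖ ^ 2 = (cpKernel S p p).re := by
  rw [← hκ.inner_eq, ← RCLike.re_eq_complex_re, inner_self_eq_norm_sq]

/-- For a unit vector y, p = |y⟩⟨y| has 1 - p = (1 - p)*(1 - p), so S_p(v,v) ≤ S_I(v,v); the general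
case follows by scaling. -/
theorem norm_le (hκ : IsGramFamily S κ) (hcp : IsCP S) (v : V) (x : K) (ξ : H) :
    ‖κ (v, x, ξ)‖ ≤ √(inner ℂ ξ (S 1 v v ξ)).re * ‖x‖ := by
  by_cases hx : x = 0
  · simp [hx, hκ.zero_left]
  have hx' : ‖x‖ ≠ 0 := norm_ne_zero_iff.2 hx
  have hunit : ∀ y : K, ‖y‖ = 1 → ‖κ (v, y, ξ)‖ ≤ √(inner ℂ ξ (S 1 v v ξ)).re := by
    intro y hy
    refine Real.le_sqrt_of_sq_le ?_
    rw [hκ.norm_sq]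
    set p := InnerProductSpace.rankOne ℂ y y with hp
    have hpp : p * p = p := InnerProductSpace.isIdempotentElem_rankOne_self hy
    have hps : star p = p := by
      rw [ContinuousLinearMap.star_eq_adjoint, hp, InnerProductSpace.adjoint_rankOne]
    have e : star (1 - p) * (1 - p) = 1 - p := by
      rw [star_sub, star_one, hps, sub_mul, mul_sub, mul_sub, hpp]
      simp
    have h := (hcp.isPositive_star_mul (1 - p) v).re_inner_nonneg_right ξ
    rw [e] at h
    simp only [map_sub, Pi.sub_apply, sub_apply, inner_sub_right, RCLike.re_eq_complex_re]
      at h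
    have : cpKernel S (v, y, ξ) (v, y, ξ) = inner ℂ ξ (S p v v ξ) := rfl
    rw [this]
    linarith
  have h1 := hunit (((‖x‖⁻¹ : ℝ) : ℂ) • x) (by
    rw [norm_smul, Complex.norm_real, norm_inv, norm_norm, inv_mul_cancel₀ hx'])
  rw [hκ.smul_left, norm_smul, RCLike.norm_conj, Complex.norm_real, norm_inv, norm_norm] at h1
  rwa [inv_mul_le_iff₀ (lt_of_le_of_ne (norm_nonneg _) (Ne.symm hx')), mul_comm] at h1

/-- The functional `x ↦ ⟪κ(v, x, ξ), y⟫` is linear and bounded. -/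
theorem exists_inner_clm (hκ : IsGramFamily S κ) (hcp : IsCP S) (v : V) (ξ : H) (y : K') :
    ∃ φ : K →L[ℂ] ℂ, ∀ x, φ x = inner ℂ (κ (v, x, ξ)) y := by
  refine ⟨LinearMap.mkContinuous
    { toFun := fun x => inner ℂ (κ (v, x, ξ)) y
      map_add' := fun x x' => by
        have := hκ.add_smul_left v 1 x x' ξ
        simp only [one_smul, map_one] at this
        rw [this, inner_add_left]
      map_smul' := fun c x => by
        simp [hκ.smul_left, mul_comm] }
    (√(inner ℂ ξ (S 1 v v ξ)).re * ‖y‖) fun x => ?_, fun x => rfl⟩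
  calc ‖inner ℂ (κ (v, x, ξ)) y‖ ≤ ‖κ (v, x, ξ)‖ * ‖y‖ := norm_inner_le_norm _ _
    _ ≤ (√(inner ℂ ξ (S 1 v v ξ)).re * ‖x‖) * ‖y‖ :=
        mul_le_mul_of_nonneg_right (hκ.norm_le hcp v x ξ) (norm_nonneg _)
    _ = _ := by ring

theorem orthogonalFamily_leftSlice {ι : Type*} (e : HilbertBasis ι ℂ K) :
    OrthogonalFamily ℂ (fun _ : ι => K') fun i =>
      (⟨(leftSlice K' (e i)).toLinearMap, fun y => by
        simp [leftSlice_apply, norm_htmul, e.orthonormal.1 i]⟩ :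
          K' →ₗᵢ[ℂ] HilbertTensor K K') := by
  intro i j hij y y'
  change inner ℂ (htmul (e i) y) (htmul (e j) y') = 0
  rw [inner_htmul, e.orthonormal.2 hij, zero_mul]

/-- The terms e_i ⊗ κ(v,e_i,ξ) are orthogonal and normality sums their squared norms. The pairing
formula determines z, so linearity in v and ξ will follow from that of κ. -/
theorem exists_dilation_vector {ι : Type*} (hκ : IsGramFamily S κ) (hs : ∀ b, IsSesqForm (S b))
    (hcp : IsCP S) (hn : IsNormal S) (e : HilbertBasis ι ℂ K) (v : V) (ξ : H) :
    ∃ z : HilbertTensor K K', (∀ x y, inner ℂ z (htmul x y) = inner ℂ (κ (v, x, ξ)) y) ∧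
      HasSum (fun i => htmul (e i) (κ (v, e i, ξ))) z ∧
      ‖z‖ ^ 2 = (inner ℂ ξ (S 1 v v ξ)).re := by
  have h1 : HasSum (fun i => ‖κ (v, e i, ξ)‖ ^ 2) (inner ℂ ξ (S 1 v v ξ)).re := by
    have := (hn.hasSum_cpKernel hs e 1 v v ξ ξ).mapL Complex.reCLM
    simpa only [Complex.reCLM_apply, one_apply_eq_self, ← hκ.norm_sq] using this
  have h2 : Summable fun i => htmul (e i) (κ (v, e i, ξ)) :=
    ((orthogonalFamily_leftSlice (K' := K') e).summable_iff_norm_sq_summable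
      fun i => κ (v, e i, ξ)).2 h1.summable
  have h3 : ∀ x y, inner ℂ (∑' i, htmul (e i) (κ (v, e i, ξ))) (htmul x y) =
      inner ℂ (κ (v, x, ξ)) y := by
    intro x y
    have h4 := h2.hasSum.mapL ((innerSL ℂ).flip (htmul x y))
    simp only [ContinuousLinearMap.flip_apply, innerSL_apply_apply] at h4
    -- Boundedness of φ lets it be applied termwise to the basis expansion of x, which reproduces
    -- the series.
    obtain ⟨φ, hφ⟩ := hκ.exists_inner_clm hcp v ξ y
    have h5 := (e.hasSum_repr x).mapL φ
    rw [← hφ]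
    have h6 : (fun i => inner ℂ (htmul (e i) (κ (v, e i, ξ))) (htmul x y)) =
        fun i => φ (e.repr x i • e i) := by
      funext i
      rw [HilbertBasis.repr_apply_apply, map_smul, inner_htmul, hφ, smul_eq_mul]
    rw [h6] at h4
    exact h4.unique h5
  refine ⟨∑' i, htmul (e i) (κ (v, e i, ξ)), h3, h2.hasSum, ?_⟩
  have h4 := (h2.hasSum.mapL (innerSL ℂ (∑' i, htmul (e i) (κ (v, e i, ξ))))).mapL Complex.reCLM
  simp only [innerSL_apply_apply, h3, Complex.reCLM_apply, ← RCLike.re_eq_complex_re, inner_self_eq_norm_sq] at h4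
  exact h4.unique h1

/-- The dilation map `J`, determined by `⟪(J v) ξ, x ⊗ y⟫ = ⟪κ(v, x, ξ), y⟫`. -/
theorem exists_dilation {ι : Type*} (hκ : IsGramFamily S κ) (hs : ∀ b, IsSesqForm (S b))
    (hcp : IsCP S) (hn : IsNormal S) (e : HilbertBasis ι ℂ K) :
    ∃ J : V →ₗ[ℂ] (H →L[ℂ] HilbertTensor K K'),
      (∀ v ξ x y, inner ℂ (J v ξ) (htmul x y) = inner ℂ (κ (v, x, ξ)) y) ∧
      ∀ v ξ, HasSum (fun i => htmul (e i) (κ (v, e i, ξ))) (J v ξ) := by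
  choose Z hZ hZs hZn using hκ.exists_dilation_vector hs hcp hn e
  have hadd : ∀ v ξ η, Z v (ξ + η) = Z v ξ + Z v η := fun v ξ η =>
    eq_of_inner_htmul fun x y => by
      have := hκ.add_smul_right v 1 x ξ η
      rw [one_smul, one_smul] at this
      rw [inner_add_left, hZ, hZ, hZ, this, inner_add_left]
  have hzero : ∀ v, Z v 0 = 0 := fun v => by simpa using hadd v 0 0
  have hsmul : ∀ v (c : ℂ) ξ, Z v (c • ξ) = c • Z v ξ := fun v c ξ =>
    eq_of_inner_htmul fun x y => by
      have h0 : κ (v, x, 0) = 0 := eq_of_inner_total hκ.dense fun q => by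
        simp [hκ.inner_eq, cpKernel]
      have := hκ.add_smul_right v c x 0 ξ
      rw [zero_add, h0, zero_add] at this
      rw [inner_smul_left, hZ, hZ, this, inner_smul_left]
  have hlin : ∀ v w (c : ℂ) ξ, Z (v + c • w) ξ = Z v ξ + c • Z w ξ := fun v w c ξ =>
    eq_of_inner_htmul fun x y => by
      rw [inner_add_left, inner_smul_left, hZ, hZ, hZ, hκ.add_smul_module hs, inner_add_left,
        inner_smul_left]
  have hzero' : ∀ ξ, Z 0 ξ = 0 := fun ξ => by simpa using hlin 0 0 1 ξ
  let j : V → (H →L[ℂ] HilbertTensor K K') := fun v => LinearMap.mkContinuous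
    { toFun := Z v, map_add' := hadd v, map_smul' := hsmul v } (√‖S 1 v v‖) fun ξ => by
      refine abs_le_of_sq_le_sq' ?_ (by positivity) |>.2
      rw [mul_pow, Real.sq_sqrt (norm_nonneg _)]
      change ‖Z v ξ‖ ^ 2 ≤ _
      rw [hZn]
      calc (inner ℂ ξ (S 1 v v ξ)).re ≤ ‖inner ℂ ξ (S 1 v v ξ)‖ := Complex.re_le_norm _
        _ ≤ ‖ξ‖ * ‖S 1 v v ξ‖ := norm_inner_le_norm _ _
        _ ≤ ‖ξ‖ * (‖S 1 v v‖ * ‖ξ‖) :=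
            mul_le_mul_of_nonneg_left ((S 1 v v).le_opNorm ξ) (norm_nonneg _)
        _ = _ := by ring
  refine ⟨{ toFun := j, map_add' := fun v w => ?_, map_smul' := fun c v => ?_ }, hZ, hZs⟩
  · ext1 ξ
    have := hlin v w 1 ξ
    rw [one_smul, one_smul] at this
    exact this
  · ext1 ξ
    have := hlin 0 v c ξ
    rw [zero_add, hzero', zero_add] at this
    exact this

end IsGramFamily

end Gram

open scoped ComplexConjugate

/-! ### Dilation formula and density -/

section Dilation

variable {H : Type*} [NormedAddCommGroup H] [InnerProductSpace ℂ H] [CompleteSpace H]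
  {K : Type*} [NormedAddCommGroup K] [InnerProductSpace ℂ K] [CompleteSpace K]
  {V : Type*} [AddCommGroup V] [Module ℂ V] [Module (H →L[ℂ] H)ᵐᵒᵖ V]
  {S : (K →L[ℂ] K) →ₗ[ℂ] (V → V → (H →L[ℂ] H))}
  {K' : Type*} [NormedAddCommGroup K'] [InnerProductSpace ℂ K'] [CompleteSpace K']
  {κ : V × K × H → K'} {J : V →ₗ[ℂ] (H →L[ℂ] HilbertTensor K K')}

/-- `J` is the dilation associated with the Gram family `κ`. -/
def IsDilation (κ : V × K × H → K') (J : V →ₗ[ℂ] (H →L[ℂ] HilbertTensor K K')) : Prop :=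
  ∀ v ξ x y, inner ℂ (J v ξ) (htmul x y) = inner ℂ (κ (v, x, ξ)) y

theorem IsDilation.isModuleMap (hJ : IsDilation κ J) (hκ : IsGramFamily S κ)
    (hs : ∀ b, IsSesqForm (S b)) : IsModuleMap J := fun v a => by
  ext1 ξ
  refine eq_of_inner_htmul fun x y => ?_
  rw [hJ, hκ.op_smul hs, ContinuousLinearMap.comp_apply, hJ]

/-- Rank-one operators on the first factor recover κ from J; density and uniqueness of D both rest
on this. -/
theorem IsDilation.opTensor_rankOne (hJ : IsDilation κ J) (x x' : K) (D : K' →L[ℂ] K') (v : V)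
    (ξ : H) : opTensor (InnerProductSpace.rankOne ℂ x x') D (J v ξ) =
      htmul x (D (κ (v, x', ξ))) := by
  refine eq_of_inner_htmul fun z y => ?_
  rw [inner_opTensor_left, opTensor_htmul, ContinuousLinearMap.star_eq_adjoint,
    InnerProductSpace.adjoint_rankOne, InnerProductSpace.rankOne_apply, htmul_smul_left,
    inner_smul_right, hJ, inner_htmul, ContinuousLinearMap.star_eq_adjoint,
    ContinuousLinearMap.adjoint_inner_right]

theorem IsDilation.inner_opTensor_rankOne (hJ : IsDilation κ J) (x x' : K) (D : K' →L[ℂ] K')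
    (v w : V) (ξ η : H) :
    inner ℂ (J v ξ) (opTensor (InnerProductSpace.rankOne ℂ x x') D (J w η)) =
      inner ℂ (κ (v, x, ξ)) (D (κ (w, x', η))) := by
  rw [hJ.opTensor_rankOne, hJ]

/-- An operator `D` on `K'` whose matrix elements are given by a normal map `S'` implements
`S'`. -/
theorem IsDilation.eq_compression {ι : Type*} (hJ : IsDilation κ J) (e : HilbertBasis ι ℂ K)
    (hJs : ∀ v ξ, HasSum (fun i => htmul (e i) (κ (v, e i, ξ))) (J v ξ))
    {S' : (K →L[ℂ] K) →ₗ[ℂ] (V → V → (H →L[ℂ] H))} (hs : ∀ b, IsSesqForm (S' b))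
    (hn : IsNormal S') {D : K' →L[ℂ] K'} (hD : ∀ p q, inner ℂ (κ p) (D (κ q)) = cpKernel S' p q)
    (b : K →L[ℂ] K) (v w : V) :
    S' b v w = ContinuousLinearMap.adjoint (J v) ∘L opTensor b D ∘L J w := by
  ext1 η
  refine ext_inner_left ℂ fun ξ => ?_
  rw [ContinuousLinearMap.comp_apply, ContinuousLinearMap.adjoint_inner_right,
    ContinuousLinearMap.comp_apply]
  -- The i-th term is ⟪κ(v, b e_i, ξ), D κ(w, e_i, η)⟫, matching the expansion of S'_b given by
  -- normality.
  have h1 := (hJs w η).mapL (innerSL ℂ (J v ξ) ∘L opTensor b D)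
  simp only [ContinuousLinearMap.comp_apply, innerSL_apply_apply, opTensor_htmul, hJ _ _ _ _,
    hD] at h1
  exact (hn.hasSum_cpKernel hs e b v w ξ η).unique h1

/-- `L(H)`-linearity absorbs right multiplication by rank-one operators into v, and the ranges
contain every x ⊗ κ(v,x',ξ), a total set. -/
theorem IsDilation.dense (hJ : IsDilation κ J) (hκ : IsGramFamily S κ) (hJm : IsModuleMap J) :
    @Dense _ (sigmaStrong H (HilbertTensor K K'))
        (Submodule.span ℂ {x : H →L[ℂ] HilbertTensor K K' |
          ∃ (b : K →L[ℂ] K) (v : V), x = opTensor b (1 : K' →L[ℂ] K') ∘L J v} :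
          Set (H →L[ℂ] HilbertTensor K K')) := by
  refine sigmaStrong_dense _ (fun T hT ξ η => ?_) ?_
  · rw [← InnerProductSpace.comp_rankOne]
    induction hT using Submodule.span_induction with
    | mem T hT =>
      obtain ⟨b, v, rfl⟩ := hT
      refine Submodule.subset_span
        ⟨b, MulOpposite.op (InnerProductSpace.rankOne ℂ ξ η) • v, ?_⟩
      rw [hJm, ContinuousLinearMap.comp_assoc]
    | zero => simp
    | add T T' _ _ hT hT' =>
      rw [ContinuousLinearMap.add_comp]
      exact Submodule.add_mem _ hT hT'
    | smul c T _ hT =>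
      rw [ContinuousLinearMap.smul_comp]
      exact Submodule.smul_mem _ c hT
  · refine (dense_span_htmul (dense_span_range_id (E := K)) hκ.dense).mono ?_
    refine Submodule.span_mono ?_
    rintro _ ⟨⟨x, v, x', ξ⟩, rfl⟩
    refine ⟨opTensor (InnerProductSpace.rankOne ℂ x x') 1 ∘L J v,
      Submodule.subset_span ⟨_, v, rfl⟩, ξ, ?_⟩
    rw [ContinuousLinearMap.comp_apply, hJ.opTensor_rankOne]
    rfl

end Dilation

/-! ### Compressions by operators on the second factor -/

section Compression

variable {H : Type*} [NormedAddCommGroup H] [InnerProductSpace ℂ H] [CompleteSpace H]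
  {K : Type*} [NormedAddCommGroup K] [InnerProductSpace ℂ K] [CompleteSpace K]
  {V : Type*} [AddCommGroup V] [Module ℂ V] [Module (H →L[ℂ] H)ᵐᵒᵖ V]
  {K' : Type*} [NormedAddCommGroup K'] [InnerProductSpace ℂ K'] [CompleteSpace K']

/-- The map `b ↦ ((v, w) ↦ (J v)* (b ⊗ D) (J w))`. -/
def compress (J : V →ₗ[ℂ] (H →L[ℂ] HilbertTensor K K')) (D : K' →L[ℂ] K') :
    (K →L[ℂ] K) →ₗ[ℂ] (V → V → (H →L[ℂ] H)) where
  toFun b v w := ContinuousLinearMap.adjoint (J v) ∘L opTensor b D ∘L J w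
  map_add' b b' := by
    funext v w
    simp [opTensor_add_left]
  map_smul' c b := by
    funext v w
    simp [opTensor_smul_left]

theorem compress_apply (J : V →ₗ[ℂ] (H →L[ℂ] HilbertTensor K K')) (D : K' →L[ℂ] K')
    (b : K →L[ℂ] K) (v w : V) :
    compress J D b v w = ContinuousLinearMap.adjoint (J v) ∘L opTensor b D ∘L J w := rfl

theorem inner_compress (J : V →ₗ[ℂ] (H →L[ℂ] HilbertTensor K K')) (D : K' →L[ℂ] K')
    (b : K →L[ℂ] K) (v w : V) (ξ η : H) :
    inner ℂ ξ (compress J D b v w η) = inner ℂ (J v ξ) (opTensor b D (J w η)) := by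
  rw [compress_apply, ContinuousLinearMap.comp_apply, ContinuousLinearMap.adjoint_inner_right,
    ContinuousLinearMap.comp_apply]

variable {J : V →ₗ[ℂ] (H →L[ℂ] HilbertTensor K K')}

theorem isSesqForm_compress (hJ : IsModuleMap J) (D : K' →L[ℂ] K') (b : K →L[ℂ] K) :
    IsSesqForm (compress J D b) where
  add_smul_right u v w c := by simp [compress_apply]
  add_smul_left u v w c := by
    have h : ContinuousLinearMap.adjoint (c • J w) = star c • ContinuousLinearMap.adjoint (J w) :=
      map_smulₛₗ _ c (J w)
    simp [compress_apply, h]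
  op_right u v a := by
    rw [compress_apply, hJ]
    rfl
  op_left u v a := by
    rw [compress_apply, hJ, ContinuousLinearMap.adjoint_comp]
    rfl

/-- The double sum equals T* (1 ⊗ D) T with T = ∑ (b_j ⊗ 1) J v_j. -/
theorem isCP_compress (J : V →ₗ[ℂ] (H →L[ℂ] HilbertTensor K K')) {D : K' →L[ℂ] K'}
    (hD : (opTensor (1 : K →L[ℂ] K) D).IsPositive) : IsCP (compress J D) := by
  intro n b v
  have h := hD.adjoint_conj (∑ j, opTensor (b j) 1 ∘L J (v j))
  convert h using 1
  ext1 η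
  refine ext_inner_left ℂ fun ξ => ?_
  rw [ContinuousLinearMap.comp_apply, ContinuousLinearMap.adjoint_inner_right]
  simp only [sum_apply, inner_sum, sum_inner, inner_compress, ContinuousLinearMap.comp_apply,
    map_sum]
  rw [Finset.sum_comm]
  refine Finset.sum_congr rfl fun j _ => Finset.sum_congr rfl fun k _ => ?_
  rw [inner_opTensor_left, opTensor_opTensor, opTensor_opTensor]
  simp

theorem isNormal_compress (J : V →ₗ[ℂ] (H →L[ℂ] HilbertTensor K K')) (D : K' →L[ℂ] K') :
    IsNormal (compress J D) := fun v => continuous_compression (J v) (J v) D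

variable {G : Type*} [Group G] {U : G →* (V ≃ₗ[(H →L[ℂ] H)ᵐᵒᵖ] V)}
  {β : G →* ((K →L[ℂ] K) ≃⋆ₐ[ℂ] (K →L[ℂ] K))}

theorem map_apply_inv_apply (U : G →* (V ≃ₗ[(H →L[ℂ] H)ᵐᵒᵖ] V)) (g : G) (v : V) :
    U g (U g⁻¹ v) = v := by
  rw [map_inv]
  exact LinearEquiv.apply_symm_apply (U g) v

theorem map_inv_apply_apply (U : G →* (V ≃ₗ[(H →L[ℂ] H)ᵐᵒᵖ] V)) (g : G) (v : V) :
    U g⁻¹ (U g v) = v := by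
  rw [map_inv]
  exact LinearEquiv.symm_apply_apply (U g) v

theorem isCovariant_compress {u : G → unitary (K →L[ℂ] K)} {u' : G → unitary (K' →L[ℂ] K')}
    (hβ : ∀ g b, β g b = (u g : K →L[ℂ] K) * b * star (u g : K →L[ℂ] K))
    (hJ : ∀ g v, J (U g v) = opTensor (u g : K →L[ℂ] K) (u' g : K' →L[ℂ] K') ∘L J v)
    {D : K' →L[ℂ] K'} (hD : ∀ g, D * (u' g : K' →L[ℂ] K') = (u' g : K' →L[ℂ] K') * D) :
    IsCovariant β U (compress J D) := by
  intro g b v w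
  obtain ⟨v, rfl⟩ := (U g).surjective v
  obtain ⟨w, rfl⟩ := (U g).surjective w
  rw [map_inv_apply_apply, map_inv_apply_apply]
  ext1 η
  refine ext_inner_left ℂ fun ξ => ?_
  rw [inner_compress, inner_compress, hJ, hJ, ContinuousLinearMap.comp_apply,
    ContinuousLinearMap.comp_apply, inner_opTensor_left, opTensor_opTensor, opTensor_opTensor, hβ,
    mul_assoc _ D, hD]
  congr 3
  · rw [← mul_assoc, ← mul_assoc, Unitary.coe_star_mul_self, one_mul, mul_assoc,
      Unitary.coe_star_mul_self, mul_one]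
  · rw [← mul_assoc, Unitary.coe_star_mul_self, one_mul]

end Compression

/-! ### The multiplier representation on the second factor -/

section Symmetry

variable {H : Type*} [NormedAddCommGroup H] [InnerProductSpace ℂ H] [CompleteSpace H]
  {K : Type*} [NormedAddCommGroup K] [InnerProductSpace ℂ K] [CompleteSpace K]
  {V : Type*} [AddCommGroup V] [Module ℂ V] [Module (H →L[ℂ] H)ᵐᵒᵖ V]
  {S : (K →L[ℂ] K) →ₗ[ℂ] (V → V → (H →L[ℂ] H))}
  {K' : Type*} [NormedAddCommGroup K'] [InnerProductSpace ℂ K'] [CompleteSpace K']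
  {κ : V × K × H → K'} {J : V →ₗ[ℂ] (H →L[ℂ] HilbertTensor K K')}
  {G : Type*} [Group G] {U : G →* (V ≃ₗ[(H →L[ℂ] H)ᵐᵒᵖ] V)}
  {β : G →* ((K →L[ℂ] K) ≃⋆ₐ[ℂ] (K →L[ℂ] K))} {u : G → unitary (K →L[ℂ] K)}
  {m : G → G → Circle}

theorem cpKernel_symm (hcov : IsCovariant β U S)
    (hβ : ∀ g b, β g b = (u g : K →L[ℂ] K) * b * star (u g : K →L[ℂ] K))
    (g : G) (v w : V) (x y : K) (ξ η : H) :
    cpKernel S (U g v, (u g : K →L[ℂ] K) x, ξ) (U g w, (u g : K →L[ℂ] K) y, η) =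
      cpKernel S (v, x, ξ) (w, y, η) := by
  have h := hcov g (InnerProductSpace.rankOne ℂ x y) (U g v) (U g w)
  rw [map_inv_apply_apply, map_inv_apply_apply] at h
  have e : β g (InnerProductSpace.rankOne ℂ x y) =
      InnerProductSpace.rankOne ℂ ((u g : K →L[ℂ] K) x) ((u g : K →L[ℂ] K) y) := by
    rw [hβ]
    ext z
    simp [ContinuousLinearMap.star_eq_adjoint, ContinuousLinearMap.adjoint_inner_right]
  rw [cpKernel, cpKernel, ← h, e]

/-- A kernel-preserving surjection of the index set is implemented by a unitary. -/
theorem exists_unitary_of_inner_eq {X : Type*} {κ : X → K'}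
    (hκ : Dense (Submodule.span ℂ (Set.range κ) : Set K')) (σ : X → X)
    (hσ : Function.Surjective σ) (h : ∀ p q, inner ℂ (κ (σ p)) (κ (σ q)) = inner ℂ (κ p) (κ q)) :
    ∃ T : unitary (K' →L[ℂ] K'), ∀ p, (T : K' →L[ℂ] K') (κ p) = κ (σ p) := by
  obtain ⟨T, hT⟩ := exists_contraction_of_dominated (κ' := κ ∘ σ) hκ fun f => by
    refine le_of_eq ?_
    rw [← sq_eq_sq₀ (norm_nonneg _) (norm_nonneg _), ← inner_self_eq_norm_sq (𝕜 := ℂ),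
      ← inner_self_eq_norm_sq (𝕜 := ℂ), inner_linearCombination, inner_linearCombination]
    simp only [Function.comp_apply, h]
  have h1 : ∀ q, star T (T (κ q)) = κ q := fun q => by
    refine eq_of_inner_total hκ fun p => ?_
    rw [ContinuousLinearMap.star_eq_adjoint, ContinuousLinearMap.adjoint_inner_right, hT, hT]
    exact h p q
  refine ⟨⟨T, ?_⟩, hT⟩
  rw [Unitary.mem_iff]
  constructor
  · refine ContinuousLinearMap.ext_on hκ ?_
    rintro _ ⟨q, rfl⟩
    exact h1 q
  · refine ContinuousLinearMap.ext_on hκ ?_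
    rintro _ ⟨q, rfl⟩
    -- Surjectivity of σ upgrades the isometry to a unitary: T T* is checked on vectors T κ(p).
    obtain ⟨p, rfl⟩ := hσ q
    have : T (κ p) = κ (σ p) := hT p
    rw [← this]
    exact congrArg T (h1 p)

theorem IsGramFamily.exists_unitary (hκ : IsGramFamily S κ) (hcov : IsCovariant β U S)
    (hβ : ∀ g b, β g b = (u g : K →L[ℂ] K) * b * star (u g : K →L[ℂ] K)) :
    ∃ u' : G → unitary (K' →L[ℂ] K'), ∀ g v x ξ,
      (u' g : K' →L[ℂ] K') (κ (v, x, ξ)) = κ (U g v, (u g : K →L[ℂ] K) x, ξ) := by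
  have : ∀ g, ∃ T : unitary (K' →L[ℂ] K'), ∀ p : V × K × H,
      (T : K' →L[ℂ] K') (κ p) = κ (U g p.1, (u g : K →L[ℂ] K) p.2.1, p.2.2) := fun g => by
    refine exists_unitary_of_inner_eq hκ.dense
      (fun p => (U g p.1, (u g : K →L[ℂ] K) p.2.1, p.2.2)) ?_ fun p q => ?_
    · rintro ⟨v, x, ξ⟩
      refine ⟨(U g⁻¹ v, star (u g : K →L[ℂ] K) x, ξ), ?_⟩
      have : (u g : K →L[ℂ] K) (star (u g : K →L[ℂ] K) x) = x :=
        congrArg (fun T : K →L[ℂ] K => T x) (Unitary.coe_mul_star_self (u g))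
      simp only [this, map_apply_inv_apply]
    · rw [hκ.inner_eq, hκ.inner_eq]
      exact cpKernel_symm hcov hβ g _ _ _ _ _ _
  choose u' hu' using this
  exact ⟨u', fun g v x ξ => hu' g (v, x, ξ)⟩

theorem Implements.unitary_one (hu : Implements β u m) : (u 1 : K →L[ℂ] K) = 1 := by
  have h := hu.mul 1 1
  rw [mul_one, hu.cocycle.one_left, Circle.coe_one, one_smul] at h
  have h2 := congrArg (fun T => star (u 1 : K →L[ℂ] K) * T) h
  simpa [← mul_assoc] using h2.symm

theorem Implements.mul_apply (hu : Implements β u m) (g h : G) (x : K) :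
    (u g : K →L[ℂ] K) ((u h : K →L[ℂ] K) x) =
      conj (m g h : ℂ) • (u (g * h) : K →L[ℂ] K) x := by
  rw [hu.mul, smul_apply, smul_smul, ← Circle.coe_inv_eq_conj, ← Circle.coe_mul, inv_mul_cancel,
    Circle.coe_one, one_smul]
  rfl

/-- Here u_g u_h carries the conjugate of m(g,h), and antilinearity of κ in x conjugates it back. -/
theorem IsGramFamily.isMultiplierRep (hκ : IsGramFamily S κ) (hu : Implements β u m)
    {u' : G → unitary (K' →L[ℂ] K')}
    (hu' : ∀ g v x ξ, (u' g : K' →L[ℂ] K') (κ (v, x, ξ)) = κ (U g v, (u g : K →L[ℂ] K) x, ξ)) :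
    IsMultiplierRep m u' := by
  constructor
  · refine Subtype.ext (ContinuousLinearMap.ext_on hκ.dense ?_)
    rintro _ ⟨⟨v, x, ξ⟩, rfl⟩
    rw [hu', hu.unitary_one, map_one]
    rfl
  · intro g h
    refine ContinuousLinearMap.ext_on hκ.dense ?_
    rintro _ ⟨⟨v, x, ξ⟩, rfl⟩
    rw [mul_apply_eq_comp, smul_apply, hu', hu', hu', hu.mul_apply, hκ.smul_left, Complex.conj_conj,
      map_mul]
    rfl

theorem IsDilation.covariant (hJ : IsDilation κ J) {u' : G → unitary (K' →L[ℂ] K')}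
    (hu' : ∀ g v x ξ, (u' g : K' →L[ℂ] K') (κ (v, x, ξ)) = κ (U g v, (u g : K →L[ℂ] K) x, ξ))
    (g : G) (v : V) :
    J (U g v) = opTensor (u g : K →L[ℂ] K) (u' g : K' →L[ℂ] K') ∘L J v := by
  ext1 ξ
  refine eq_of_inner_htmul fun x y => ?_
  have : (u g : K →L[ℂ] K) (star (u g : K →L[ℂ] K) x) = x :=
    congrArg (fun T : K →L[ℂ] K => T x) (Unitary.coe_mul_star_self (u g))
  rw [ContinuousLinearMap.comp_apply, inner_opTensor_left, opTensor_htmul, hJ, hJ,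
    ContinuousLinearMap.star_eq_adjoint (u' g : K' →L[ℂ] K'),
    ContinuousLinearMap.adjoint_inner_right, hu', this]

end Symmetry

/-! ### Extremality and the Radon–Nikodym operator -/

section Extreme

variable {H : Type*} [NormedAddCommGroup H] [InnerProductSpace ℂ H] [CompleteSpace H]
  {K : Type*} [NormedAddCommGroup K] [InnerProductSpace ℂ K] [CompleteSpace K]
  {V : Type*} [AddCommGroup V] [Module ℂ V] [Module (H →L[ℂ] H)ᵐᵒᵖ V]
  {S : (K →L[ℂ] K) →ₗ[ℂ] (V → V → (H →L[ℂ] H))}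
  {K' : Type*} [NormedAddCommGroup K'] [InnerProductSpace ℂ K'] [CompleteSpace K']
  {κ : V × K × H → K'} {J : V →ₗ[ℂ] (H →L[ℂ] HilbertTensor K K')}
  {G : Type*} [Group G] {U : G →* (V ≃ₗ[(H →L[ℂ] H)ᵐᵒᵖ] V)}
  {β : G →* ((K →L[ℂ] K) ≃⋆ₐ[ℂ] (K →L[ℂ] K))} {u : G → unitary (K →L[ℂ] K)}
  {s₁ : V → V → (H →L[ℂ] H)}

theorem cpKernel_add (S T : (K →L[ℂ] K) →ₗ[ℂ] (V → V → (H →L[ℂ] H))) (p q : V × K × H) :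
    cpKernel (S + T) p q = cpKernel S p q + cpKernel T p q := by
  simp [cpKernel]

theorem cpKernel_smul (a : ℝ) (S : (K →L[ℂ] K) →ₗ[ℂ] (V → V → (H →L[ℂ] H)))
    (p q : V × K × H) : cpKernel (a • S) p q = a * cpKernel S p q := by
  simp [cpKernel]

theorem opTensor_one_isPositive {D : K' →L[ℂ] K'} (hD : IsSelfAdjoint D) (h : ‖D‖ ≤ 1) :
    (opTensor (1 : K →L[ℂ] K) (1 + D)).IsPositive := by
  rw [ContinuousLinearMap.isPositive_def']
  refine ⟨?_, fun z => ?_⟩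
  · rw [IsSelfAdjoint, ContinuousLinearMap.star_eq_adjoint, adjoint_opTensor, star_add, star_one,
      star_one, hD.star_eq]
  · rw [ContinuousLinearMap.reApplyInnerSelf_apply, opTensor_add_right, opTensor_one, add_apply,
      inner_add_left, map_add, one_apply_eq_self, inner_self_eq_norm_sq]
    have h1 : ‖opTensor (1 : K →L[ℂ] K) D z‖ ≤ ‖z‖ := by
      refine (ContinuousLinearMap.le_opNorm _ _).trans ?_
      refine mul_le_of_le_one_left (norm_nonneg _) ((norm_opTensor_le _ _).trans ?_)
      exact mul_le_one₀ ContinuousLinearMap.norm_id_le (norm_nonneg _) h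
    have h2 := abs_le.1 ((RCLike.abs_re_le_norm (inner ℂ (opTensor (1 : K →L[ℂ] K) D z) z)).trans
      (norm_inner_le_norm _ _))
    nlinarith [norm_nonneg z, h2.1]

theorem compress_add_right (J : V →ₗ[ℂ] (H →L[ℂ] HilbertTensor K K')) (D D' : K' →L[ℂ] K') :
    compress J (D + D') = compress J D + compress J D' := by
  refine LinearMap.ext fun b => ?_
  funext v w
  simp [compress_apply, opTensor_add_right]

theorem compress_smul_right (J : V →ₗ[ℂ] (H →L[ℂ] HilbertTensor K K')) (c : ℂ)
    (D : K' →L[ℂ] K') : compress J (c • D) = c • compress J D := by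
  refine LinearMap.ext fun b => ?_
  funext v w
  simp [compress_apply, opTensor_smul_right]

/-- The hypotheses of the extremality criterion: a covariant minimal dilation of `S`. -/
structure IsCovariantDilation (β : G →* ((K →L[ℂ] K) ≃⋆ₐ[ℂ] (K →L[ℂ] K)))
    (U : G →* (V ≃ₗ[(H →L[ℂ] H)ᵐᵒᵖ] V)) (u : G → unitary (K →L[ℂ] K))
    (S : (K →L[ℂ] K) →ₗ[ℂ] (V → V → (H →L[ℂ] H))) (κ : V × K × H → K')
    (J : V →ₗ[ℂ] (H →L[ℂ] HilbertTensor K K')) (u' : G → unitary (K' →L[ℂ] K')) : Prop where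
  apply_eq_conj : ∀ g b, β g b = (u g : K →L[ℂ] K) * b * star (u g : K →L[ℂ] K)
  gram : IsGramFamily S κ
  dilation : IsDilation κ J
  isModuleMap : IsModuleMap J
  eq_compress : S = compress J 1
  map_gram : ∀ g v x ξ,
    (u' g : K' →L[ℂ] K') (κ (v, x, ξ)) = κ (U g v, (u g : K →L[ℂ] K) x, ξ)

namespace IsCovariantDilation

variable {u' : G → unitary (K' →L[ℂ] K')}

theorem compress_mem_NCP (h : IsCovariantDilation β U u S κ J u') {D : K' →L[ℂ] K'}
    (hD : IsSelfAdjoint D) (hn : ‖D‖ ≤ 1)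
    (hc : ∀ g, D * (u' g : K' →L[ℂ] K') = (u' g : K' →L[ℂ] K') * D)
    (h0 : ∀ v w, compress J D 1 v w = 0) (hS : S 1 = s₁) :
    compress J (1 + D) ∈ NCP β U s₁ := by
  refine ⟨fun b => isSesqForm_compress h.isModuleMap _ b,
    isCP_compress J (opTensor_one_isPositive hD hn),
    isCovariant_compress h.apply_eq_conj (h.dilation.covariant h.map_gram) fun g => ?_,
    isNormal_compress J _, ?_⟩
  · rw [add_mul, mul_add, hc, one_mul, mul_one]
  · rw [compress_add_right, ← h.eq_compress, ← hS]
    funext v w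
    simp [h0]

/-- At b = |x⟩⟨y| the compression shows the matrix elements of D on the total family κ. -/
theorem eq_zero_of_compress_eq_zero (h : IsCovariantDilation β U u S κ J u') {D : K' →L[ℂ] K'}
    (h0 : compress J D = 0) : D = 0 := by
  refine ContinuousLinearMap.ext_on h.gram.dense ?_
  rintro _ ⟨⟨w, y, η⟩, rfl⟩
  refine eq_of_inner_total h.gram.dense ?_
  rintro ⟨v, x, ξ⟩
  rw [← h.dilation.inner_opTensor_rankOne, ← inner_compress, h0]
  simp

theorem selfAdjoint_eq_zero_of_extreme (h : IsCovariantDilation β U u S κ J u')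
    (hS : S 1 = s₁) (hext : S ∈ Set.extremePoints ℝ (NCP β U s₁)) {D : K' →L[ℂ] K'}
    (hD : IsSelfAdjoint D)
    (hc : ∀ g, D * (u' g : K' →L[ℂ] K') = (u' g : K' →L[ℂ] K') * D)
    (h0 : ∀ v w, compress J D 1 v w = 0) : D = 0 := by
  -- This gives ‖rD‖ ≤ 1, so 1 ± rD both yield elements of the convex set, with midpoint S.
  set r : ℝ := (1 + ‖D‖)⁻¹ with hr
  have hrpos : 0 < r := by positivity
  obtain ⟨D₁, hD₁⟩ : ∃ D₁ : K' →L[ℂ] K', D₁ = (r : ℂ) • D := ⟨_, rfl⟩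
  have key : ∀ t : ℝ, |t| = 1 → compress J (1 + (t : ℂ) • D₁) ∈ NCP β U s₁ := by
    intro t ht
    refine h.compress_mem_NCP ?_ ?_ (fun g => ?_) (fun v w => ?_) hS
    · rw [hD₁, IsSelfAdjoint, star_smul, star_smul, hD.star_eq]
      simp
    · rw [hD₁, norm_smul, norm_smul, Complex.norm_real, Complex.norm_real, Real.norm_eq_abs, ht,
        one_mul, Real.norm_eq_abs, abs_of_pos hrpos, hr, inv_mul_le_iff₀ (by positivity)]
      linarith
    · simp only [hD₁, smul_mul_assoc, mul_smul_comm, hc]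
    · rw [hD₁, compress_smul_right, compress_smul_right]
      simp [h0]
  have hp := key 1 (by simp)
  have hm := key (-1) (by simp)
  have hseg : S ∈ openSegment ℝ (compress J (1 + ((1 : ℝ) : ℂ) • D₁))
      (compress J (1 + ((-1 : ℝ) : ℂ) • D₁)) := by
    refine ⟨1 / 2, 1 / 2, by norm_num, by norm_num, by norm_num, ?_⟩
    rw [compress_add_right, compress_add_right, compress_smul_right, compress_smul_right,
      ← h.eq_compress]
    refine LinearMap.ext fun b => ?_
    funext v w
    simp only [LinearMap.add_apply, LinearMap.smul_apply, Pi.add_apply, Pi.smul_apply]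
    push_cast
    module
  have h1 := hext.2 hp hm hseg
  rw [compress_add_right, ← h.eq_compress, add_eq_left, Complex.ofReal_one, one_smul] at h1
  have h2 := h.eq_zero_of_compress_eq_zero h1
  rw [hD₁, smul_eq_zero] at h2
  exact h2.resolve_left (by exact_mod_cast hrpos.ne')

theorem star_commute {E : Type*} [NormedAddCommGroup E] [InnerProductSpace ℂ E] [CompleteSpace E]
    {D : E →L[ℂ] E} {w : unitary (E →L[ℂ] E)}
    (h : D * (w : E →L[ℂ] E) = (w : E →L[ℂ] E) * D) :
    star D * (w : E →L[ℂ] E) = (w : E →L[ℂ] E) * star D := by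
  have h1 : star (w : E →L[ℂ] E) * star D = star D * star (w : E →L[ℂ] E) := by
    rw [← star_mul, ← star_mul, h]
  calc star D * (w : E →L[ℂ] E)
      = (w : E →L[ℂ] E) * (star (w : E →L[ℂ] E) * star D) * (w : E →L[ℂ] E) := by
        rw [← mul_assoc, Unitary.mul_star_self_of_mem (SetLike.coe_mem _), one_mul]
    _ = (w : E →L[ℂ] E) * star D := by
        rw [h1, mul_assoc, mul_assoc, Unitary.star_mul_self_of_mem (SetLike.coe_mem _), mul_one]

/-- Both conditions pass to D*, since the u'_g are unitary; hence the self-adjoint case applies to D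
+ D* and i(D - D*). -/
theorem eq_zero_of_extreme (h : IsCovariantDilation β U u S κ J u')
    (hS : S 1 = s₁) (hext : S ∈ Set.extremePoints ℝ (NCP β U s₁)) {D : K' →L[ℂ] K'}
    (hc : ∀ g, D * (u' g : K' →L[ℂ] K') = (u' g : K' →L[ℂ] K') * D)
    (h0 : ∀ v, compress J D 1 v v = 0) : D = 0 := by
  have h1 : ∀ v w, compress J D 1 v w = 0 := fun v w => by
    rw [(isSesqForm_compress h.isModuleMap D 1).polarization]
    simp [h0]
  have h2 : ∀ v w, compress J (star D) 1 v w = 0 := fun v w => by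
    have := congrArg ContinuousLinearMap.adjoint (h1 w v)
    rw [compress_apply, ContinuousLinearMap.adjoint_comp, ContinuousLinearMap.adjoint_comp,
      ContinuousLinearMap.adjoint_adjoint, adjoint_opTensor, star_one, map_zero] at this
    exact this
  have hc' : ∀ g, star D * (u' g : K' →L[ℂ] K') = (u' g : K' →L[ℂ] K') * star D :=
    fun g => star_commute (hc g)
  have e1 : D + star D = 0 := by
    refine h.selfAdjoint_eq_zero_of_extreme hS hext (IsSelfAdjoint.add_star_self D) (fun g => ?_)
      fun v w => ?_
    · rw [add_mul, mul_add, hc, hc']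
    · rw [compress_add_right]
      simp [h1, h2]
  have e2 : Complex.I • (D + (-1 : ℂ) • star D) = 0 := by
    refine h.selfAdjoint_eq_zero_of_extreme hS hext ?_ (fun g => ?_) fun v w => ?_
    · rw [IsSelfAdjoint, star_smul, star_add, star_smul, star_star]
      simp only [RCLike.star_def, Complex.conj_I, map_neg, map_one]
      module
    · simp only [smul_mul_assoc, mul_smul_comm, add_mul, mul_add, hc, hc']
    · rw [compress_smul_right, compress_add_right, compress_smul_right]
      simp [h1, h2]
  have e3 := (smul_eq_zero.1 e2).resolve_left Complex.I_ne_zero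
  have e4 : (2 : ℂ) • D = 0 := by
    calc (2 : ℂ) • D = (D + star D) + (D + (-1 : ℂ) • star D) := by module
      _ = 0 := by rw [e1, e3, add_zero]
  exact (smul_eq_zero.1 e4).resolve_left two_ne_zero

/-- Radon–Nikodym: a completely positive map whose kernel is dominated by that of `S` is
implemented by an operator on `K'`. -/
theorem exists_radonNikodym
    {S T : (K →L[ℂ] K) →ₗ[ℂ] (V → V → (H →L[ℂ] H))} (hκ : IsGramFamily S κ) {a c : ℝ}
    (ha : 0 ≤ a) (hc : 0 ≤ c)
    {S' : (K →L[ℂ] K) →ₗ[ℂ] (V → V → (H →L[ℂ] H))} (hs' : ∀ b, IsSesqForm (S' b)) (hcp' : IsCP S')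
    (hsT : ∀ b, IsSesqForm (T b)) (hcpT : IsCP T) (hsum : a • S' + c • T = S) :
    ∃ D : K' →L[ℂ] K', ∀ p q, inner ℂ (κ p) (D (κ q)) = a * cpKernel S' p q := by
  obtain ⟨E, _, _, _, κ', hκ', -⟩ := exists_gram_family (X := V × K × H)
    (fun p q => a * cpKernel S' p q)
    (fun p q => by rw [map_mul, Complex.conj_ofReal, cpKernel_conj hs' hcp'])
    (fun f => by
      have h := mul_nonneg ha (cpKernel_pos hs' hcp' f)
      rw [← Complex.re_ofReal_mul] at h
      refine h.trans_eq (congrArg Complex.re ?_)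
      simp only [Finsupp.sum, Finset.mul_sum]
      exact Finset.sum_congr rfl fun i _ => Finset.sum_congr rfl fun j _ => by ring)
  -- The kernel of S exceeds that of aS' by the positive kernel of cT, so the Gram family of aS' is
  -- an image of κ; the operator sought is R*R.
  obtain ⟨R, hR⟩ := exists_contraction_of_dominated (κ' := κ') hκ.dense fun f => by
    rw [← sq_le_sq₀ (norm_nonneg _) (norm_nonneg _), ← inner_self_eq_norm_sq (𝕜 := ℂ),
      ← inner_self_eq_norm_sq (𝕜 := ℂ), inner_linearCombination, inner_linearCombination]
    simp only [hκ', hκ.inner_eq, ← hsum, cpKernel_add, cpKernel_smul]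
    have h := mul_nonneg hc (cpKernel_pos hsT hcpT f)
    rw [← Complex.re_ofReal_mul] at h
    have e : (f.sum fun i d => f.sum fun j d' => conj d * d' *
        (a * cpKernel S' i j + c * cpKernel T i j)) =
        (f.sum fun i d => f.sum fun j d' => conj d * d' * (a * cpKernel S' i j)) +
        c * (f.sum fun i d => f.sum fun j d' => conj d * d' * cpKernel T i j) := by
      simp only [Finsupp.sum, Finset.mul_sum, ← Finset.sum_add_distrib]
      exact Finset.sum_congr rfl fun i _ => Finset.sum_congr rfl fun j _ => by ring
    rw [e, map_add]
    exact le_add_of_nonneg_right h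
  refine ⟨ContinuousLinearMap.adjoint R ∘L R, fun p q => ?_⟩
  rw [ContinuousLinearMap.comp_apply, ContinuousLinearMap.adjoint_inner_right, hR, hR, hκ']

theorem mem_extremePoints (h : IsCovariantDilation β U u S κ J u') (hS : S ∈ NCP β U s₁)
    {ι : Type*} (e : HilbertBasis ι ℂ K)
    (hJs : ∀ v ξ, HasSum (fun i => htmul (e i) (κ (v, e i, ξ))) (J v ξ))
    (hinj : ∀ D : K' →L[ℂ] K', (∀ g, D * (u' g : K' →L[ℂ] K') = (u' g : K' →L[ℂ] K') * D) →
      (∀ v, compress J D 1 v v = 0) → D = 0) :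
    S ∈ Set.extremePoints ℝ (NCP β U s₁) := by
  refine ⟨hS, fun S₁ h₁ S₂ h₂ hseg => ?_⟩
  obtain ⟨a, c, ha, hc, -, hsum⟩ := hseg
  obtain ⟨hs₁, hcp₁, hcov₁, hn₁, hone₁⟩ := h₁
  obtain ⟨D, hD⟩ := exists_radonNikodym h.gram ha.le hc.le hs₁ hcp₁ h₂.1 h₂.2.1 hsum
  have ha' : (a : ℂ) ≠ 0 := by exact_mod_cast ha.ne'
  -- Only a S₁, not S₁ itself, is dominated by S; dividing by a afterwards recovers S₁.
  obtain ⟨D₁, hD₁k⟩ : ∃ D₁ : K' →L[ℂ] K', ∀ p q, inner ℂ (κ p) (D₁ (κ q)) = cpKernel S₁ p q :=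
    ⟨(a : ℂ)⁻¹ • D, fun p q => by
      rw [smul_apply, inner_smul_right, hD, inv_mul_cancel_left₀ ha']⟩
  have hrep : S₁ = compress J D₁ := by
    refine LinearMap.ext fun b => ?_
    funext v w
    exact h.dilation.eq_compression e hJs hs₁ hn₁ hD₁k b v w
  have hcomm : ∀ g, D₁ * (u' g : K' →L[ℂ] K') = (u' g : K' →L[ℂ] K') * D₁ := by
    intro g
    have hk : ∀ p q : V × K × H, inner ℂ ((u' g : K' →L[ℂ] K') (κ p))
        (D₁ ((u' g : K' →L[ℂ] K') (κ q))) = inner ℂ (κ p) (D₁ (κ q)) := by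
      rintro ⟨v, x, ξ⟩ ⟨w, y, η⟩
      rw [h.map_gram, h.map_gram, hD₁k, hD₁k, cpKernel_symm hcov₁ h.apply_eq_conj]
    have hstar : star (u' g : K' →L[ℂ] K') * (D₁ * (u' g : K' →L[ℂ] K')) = D₁ := by
      refine ContinuousLinearMap.ext_on h.gram.dense ?_
      rintro _ ⟨q, rfl⟩
      refine eq_of_inner_total h.gram.dense fun p => ?_
      rw [mul_apply_eq_comp, mul_apply_eq_comp, ContinuousLinearMap.star_eq_adjoint,
        ContinuousLinearMap.adjoint_inner_right]
      exact hk p q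
    calc D₁ * (u' g : K' →L[ℂ] K')
        = (u' g : K' →L[ℂ] K') * (star (u' g : K' →L[ℂ] K') * (D₁ * (u' g : K' →L[ℂ] K'))) := by
          rw [← mul_assoc, Unitary.mul_star_self_of_mem (SetLike.coe_mem _), one_mul]
      _ = (u' g : K' →L[ℂ] K') * D₁ := by rw [hstar]
  -- S₁ and S both equal s₁ at b = I, so D₁ - 1 satisfies the hypotheses of `hinj`.
  have hzero : D₁ + (-1 : ℂ) • (1 : K' →L[ℂ] K') = 0 := by
    refine hinj _ (fun g => ?_) fun v => ?_
    · simp [add_mul, mul_add, hcomm]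
    · rw [compress_add_right, compress_smul_right, ← hrep, ← h.eq_compress]
      simp [hone₁, hS.2.2.2.2]
  have hone : D₁ = 1 := by
    rw [neg_one_smul] at hzero
    exact add_neg_eq_zero.1 hzero
  rw [hrep, hone, ← h.eq_compress]

end IsCovariantDilation

end Extreme

/-! ### Kraus decomposition -/

section Kraus

open Filter Topology

variable {H : Type*} [NormedAddCommGroup H] [InnerProductSpace ℂ H] [CompleteSpace H]
  {K : Type*} [NormedAddCommGroup K] [InnerProductSpace ℂ K] [CompleteSpace K]
  {V : Type*} [AddCommGroup V] [Module ℂ V] [Module (H →L[ℂ] H)ᵐᵒᵖ V]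
  {K' : Type*} [NormedAddCommGroup K'] [InnerProductSpace ℂ K'] [CompleteSpace K']

/-- The component of `J` along `y ∈ K'`. -/
def krausMap (J : V →ₗ[ℂ] (H →L[ℂ] HilbertTensor K K')) (y : K') : V →ₗ[ℂ] (H →L[ℂ] K) where
  toFun v := ContinuousLinearMap.adjoint (rightSlice K y) ∘L J v
  map_add' v w := by simp
  map_smul' c v := by simp

theorem krausMap_apply (J : V →ₗ[ℂ] (H →L[ℂ] HilbertTensor K K')) (y : K') (v : V) :
    krausMap J y v = ContinuousLinearMap.adjoint (rightSlice K y) ∘L J v := rfl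

theorem isModuleMap_krausMap {J : V →ₗ[ℂ] (H →L[ℂ] HilbertTensor K K')} (hJ : IsModuleMap J)
    (y : K') : IsModuleMap (krausMap J y) := fun v a => by
  rw [krausMap_apply, hJ]
  rfl

/-- A finite partial sum is (J v)* (b ⊗ 1)(1 ⊗ P_F)(J w); the projections 1 ⊗ P_F are bounded and
tend strongly to 1. -/
theorem tendsto_krausMap {ι : Type*} (J : V →ₗ[ℂ] (H →L[ℂ] HilbertTensor K K'))
    (f : HilbertBasis ι ℂ K') (b : K →L[ℂ] K) (v w : V) :
    Tendsto (fun F : Finset ι => ∑ l ∈ F,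
        ContinuousLinearMap.adjoint (krausMap J (f l) v) ∘L b ∘L krausMap J (f l) w)
      atTop (@nhds _ (sigmaStrong H H) (compress J 1 b v w)) := by
  have key : ∀ F : Finset ι, ∑ l ∈ F,
      ContinuousLinearMap.adjoint (krausMap J (f l) v) ∘L b ∘L krausMap J (f l) w =
        (ContinuousLinearMap.adjoint (J v) ∘L opTensor b 1) ∘L
          (opTensor 1 (basisProj f F) ∘L J w) := by
    intro F
    ext1 η
    refine ext_inner_left ℂ fun ξ => ?_
    simp only [sum_apply, ContinuousLinearMap.comp_apply, inner_sum, krausMap_apply,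
      ContinuousLinearMap.adjoint_inner_right, opTensor_basisProj, map_sum]
    refine Finset.sum_congr rfl fun l _ => ?_
    rw [← adjoint_rightSlice_opTensor, ContinuousLinearMap.adjoint_inner_left,
      rightSlice_adjoint_rightSlice, rightSlice_adjoint_rightSlice, opTensor_opTensor,
      opTensor_opTensor]
    simp
  simp only [key]
  refine tendsto_sigmaStrong_of_bounded
    (C := ‖ContinuousLinearMap.adjoint (J v) ∘L opTensor b (1 : K' →L[ℂ] K')‖ * ‖J w‖)
    (fun F => ?_) fun ξ => ?_
  · refine (ContinuousLinearMap.opNorm_comp_le _ _).trans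
      (mul_le_mul_of_nonneg_left ?_ (norm_nonneg _))
    refine (ContinuousLinearMap.opNorm_comp_le _ _).trans
      (mul_le_of_le_one_left (norm_nonneg _) ((norm_opTensor_le _ _).trans ?_))
    exact mul_le_one₀ ContinuousLinearMap.norm_id_le (norm_nonneg _) (norm_basisProj_le f F)
  · exact ((ContinuousLinearMap.adjoint (J v) ∘L opTensor b (1 : K' →L[ℂ] K')).continuous.tendsto
      (J w ξ)).comp (tendsto_opTensor_basisProj f (J w ξ))

end Kraus

end CovCP

end

/-! ### Assembly of the theorem -/

theorem mainTheorem9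
    {H : Type uH} [NormedAddCommGroup H] [InnerProductSpace ℂ H] [CompleteSpace H]
    {K : Type uK} [NormedAddCommGroup K] [InnerProductSpace ℂ K] [CompleteSpace K]
    {V : Type uV} [AddCommGroup V] [Module ℂ V] [Module (H →L[ℂ] H)ᵐᵒᵖ V]
    [IsScalarTower ℂ (H →L[ℂ] H)ᵐᵒᵖ V]
    {G : Type uG} [Group G]
    (U : G →* (V ≃ₗ[(H →L[ℂ] H)ᵐᵒᵖ] V))
    (β : G →* ((K →L[ℂ] K) ≃⋆ₐ[ℂ] (K →L[ℂ] K)))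
    (u : G → unitary (K →L[ℂ] K)) (m : G → G → Circle) (hu : CovCP.Implements β u m)
    (s₁ : V → V → (H →L[ℂ] H))
    (S : (K →L[ℂ] K) →ₗ[ℂ] (V → V → (H →L[ℂ] H))) (hS : S ∈ CovCP.NCP β U s₁) :
    (∃ (K' : Type (max uH uK uV)) (_ : NormedAddCommGroup K') (_ : InnerProductSpace ℂ K')
        (_ : CompleteSpace K') (J : V →ₗ[ℂ] (H →L[ℂ] CovCP.HilbertTensor K K')),
      CovCP.IsModuleMap J ∧
      (∀ (b : K →L[ℂ] K) (v w : V), S b v w =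
        ContinuousLinearMap.adjoint (J v) ∘L CovCP.opTensor b (1 : K' →L[ℂ] K') ∘L J w) ∧
      @Dense _ (CovCP.sigmaStrong H (CovCP.HilbertTensor K K'))
        (Submodule.span ℂ {x : H →L[ℂ] CovCP.HilbertTensor K K' |
          ∃ (b : K →L[ℂ] K) (v : V), x = CovCP.opTensor b (1 : K' →L[ℂ] K') ∘L J v} :
          Set (H →L[ℂ] CovCP.HilbertTensor K K')) ∧
      ∃ u' : G → unitary (K' →L[ℂ] K'),
        CovCP.IsMultiplierRep m u' ∧
        (∀ (g : G) (v : V),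
          J (U g v) = CovCP.opTensor (u g : K →L[ℂ] K) (u' g : K' →L[ℂ] K') ∘L J v) ∧
        (S ∈ Set.extremePoints ℝ (CovCP.NCP β U s₁) ↔
          ∀ D' : K' →L[ℂ] K',
            (∀ g : G, D' * (u' g : K' →L[ℂ] K') = (u' g : K' →L[ℂ] K') * D') →
            (∀ v : V, ContinuousLinearMap.adjoint (J v) ∘L
              CovCP.opTensor (1 : K →L[ℂ] K) D' ∘L J v = 0) →
            D' = 0)) ∧
    (∃ (Λ : Type (max uH uK uV)) (A : Λ → V →ₗ[ℂ] (H →L[ℂ] K)),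
      (∀ l, CovCP.IsModuleMap (A l)) ∧
      ∀ (b : K →L[ℂ] K) (v w : V),
        Filter.Tendsto
          (fun F : Finset Λ => ∑ l ∈ F, ContinuousLinearMap.adjoint (A l v) ∘L b ∘L A l w)
          Filter.atTop
          (@nhds _ (CovCP.sigmaStrong H H) (S b v w))) := by
  have hNCP := hS
  obtain ⟨hs, hcp, hcov, hn, hone⟩ := hS
  obtain ⟨K', _, _, _, κ, hκ, hd⟩ := CovCP.exists_gram_family (CovCP.cpKernel S)
    (CovCP.cpKernel_conj hs hcp) (CovCP.cpKernel_pos hs hcp)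
  have gram : CovCP.IsGramFamily S κ := ⟨hκ, hd⟩
  obtain ⟨wK, e, -⟩ := exists_hilbertBasis ℂ K
  obtain ⟨J, hJ, hJs⟩ := gram.exists_dilation hs hcp hn e
  have hJm : CovCP.IsModuleMap J := CovCP.IsDilation.isModuleMap hJ gram hs
  have hrep : ∀ (b : K →L[ℂ] K) (v w : V), S b v w =
      ContinuousLinearMap.adjoint (J v) ∘L CovCP.opTensor b (1 : K' →L[ℂ] K') ∘L J w :=
    CovCP.IsDilation.eq_compression hJ e hJs hs hn hκ
  obtain ⟨u', hu'⟩ := gram.exists_unitary hcov hu.conj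
  have hS' : S = CovCP.compress J 1 := by
    refine LinearMap.ext fun b => ?_
    funext v w
    exact hrep b v w
  have hdil : CovCP.IsCovariantDilation β U u S κ J u' := ⟨hu.conj, gram, hJ, hJm, hS', hu'⟩
  refine ⟨⟨K', inferInstance, inferInstance, inferInstance, J, hJm, hrep,
    CovCP.IsDilation.dense hJ gram hJm, u', gram.isMultiplierRep hu hu',
    CovCP.IsDilation.covariant hJ hu', fun hext D hc h0 => ?_, fun hinj => ?_⟩, ?_⟩
  · exact hdil.eq_zero_of_extreme hone hext hc h0
  · exact hdil.mem_extremePoints hNCP e hJs hinj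
  · obtain ⟨wK', f, -⟩ := exists_hilbertBasis ℂ K'
    refine ⟨wK', fun l => CovCP.krausMap J (f l), fun l => CovCP.isModuleMap_krausMap hJm _,
      fun b v w => ?_⟩
    rw [hS']
    exact CovCP.tendsto_krausMap J f b v w
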